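/- For a vector $x\in\mathbb Z^n$ let $a$ be $x$ with its coordinates rearranged in non-increasing order of absolute value, and put $\|x_{-k}\|_p^p=\sum_{i>k}|a_i|^p$; $\log$ is the logarithm to base $2$. A (randomized) linear sketch consists of a random integer matrix $S\in\mathbb Z^{r\times n}$ that is determined by a string of uniformly random bits, chosen independently of the input, and of a post-processing map that computes the output from the random bits and $Sx$. Its space for inputs with entries bounded by $M$ in absolute value is the number of random bits plus $r$ times a word length $w$ such that, for every such input and every choice of the random bits, each coordinate of $Sx$ can be stored (sign and magnitude) in $w$ bits. Theorem. For every constant $c\in\mathbb R$ there is an exponent $q$ such that for all constants $p>2$, $d\in\mathbb N$ and $\delta\in(0,1)$ there is a constant $C>0$ with the following property. For all integers $n\ge 2$ and $0\le k\le n$ and all $\varepsilon\in(0,1)$ there is a linear sketch, whose space for inputs with entries bounded by $n^d$ in absolute value is at most $$C\left(\frac{\log n}{\varepsilon}\right)^{q} n^{1-2/p}$$ bits, such that for every $x\in\mathbb Z^n$ with $\|x\|_\infty\le n^d$ which satisfies $$|a_k|^p\ \ge\ \left(\frac{\varepsilon}{\log n}\right)^{c}\cdot\frac{\|x_{-k}\|_p^p}{k}$$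 (no condition if $k=0$), with probability at least $1-\delta$ over the random bits the output $Z$ satisfies $$(1-\varepsilon)\sum_{i=1}^k|a_i|^p\ \le\ Z\ \le\ (1+\varepsilon)\sum_{i=1}^k|a_i|^p .$$ -/

import Mathlib

/-- The entries of `x` rearranged in non-increasing order of absolute value: `ranked x i` is the
entry of rank `i + 1` (positions in `Fin n` are counted from `0`). -/
def ranked {n : ℕ} (x : Fin n → ℤ) : Fin n → ℤ :=
  x ∘ Tuple.sort (fun i => -|x i|)

/-- `∑_{i ≤ k} |a_i| ^ p`, the `F_p` moment of the `k` entries of largest absolute value. -/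
noncomputable def topMoment {n : ℕ} (p : ℝ) (k : ℕ) (x : Fin n → ℤ) : ℝ :=
  ∑ i ∈ Finset.univ.filter (fun i : Fin n => (i : ℕ) < k), |(ranked x i : ℝ)| ^ p

/-- `‖x_{-k}‖_p ^ p`, the `F_p` moment of `x` without its `k` entries of largest absolute value. -/
noncomputable def tailMoment {n : ℕ} (p : ℝ) (k : ℕ) (x : Fin n → ℤ) : ℝ :=
  ∑ i ∈ Finset.univ.filter (fun i : Fin n => k ≤ (i : ℕ)), |(ranked x i : ℝ)| ^ p

/-- `|a_k| ^ p ≥ θ * ‖x_{-k}‖_p ^ p / k`, where `a_k` is the entry of rank `k` (at position `k - 1`).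
There is no such entry for `k = 0`, and then nothing is required. -/
def HeadDominatesTail {n : ℕ} (p θ : ℝ) (k : ℕ) (x : Fin n → ℤ) : Prop :=
  ∀ i : Fin n, (i : ℕ) + 1 = k → |(ranked x i : ℝ)| ^ p ≥ θ * (tailMoment p k x / k)

/-- A randomized linear sketch for vectors in `ℤ ^ n`: an integer matrix `S` that is determined by
a string of uniformly random bits (drawn independently of the input vector), and a post-processing
map, which sees only the random bits and the sketched vector `S x`. Each of the counters
`(S x)_j` is kept in a word of `wordBits` bits. -/
structure LinearSketch (n : ℕ) where
  seedBits : ℕ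
  rows : ℕ
  wordBits : ℕ
  matrix : (Fin seedBits → Bool) → Matrix (Fin rows) (Fin n) ℤ
  output : (Fin seedBits → Bool) → (Fin rows → ℤ) → ℝ

namespace LinearSketch

variable {n : ℕ}

/-- The number of bits stored: the random bits and all the counters. -/
def space (A : LinearSketch n) : ℕ := A.seedBits + A.rows * A.wordBits

/-- The counters (a sign and a magnitude) never overflow their words, whatever the random bits,
on vectors whose entries are at most `M` in absolute value. -/
def Fits (A : LinearSketch n) (M : ℕ) : Prop :=
  ∀ (ω : Fin A.seedBits → Bool) (x : Fin n → ℤ), (∀ i, |x i| ≤ (M : ℤ)) →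
    ∀ j, 2 * |(A.matrix ω).mulVec x j| < 2 ^ A.wordBits

/-- The estimate computed from the random bits `ω` and the sketch of `x`. -/
def estimate (A : LinearSketch n) (ω : Fin A.seedBits → Bool) (x : Fin n → ℤ) : ℝ :=
  A.output ω ((A.matrix ω).mulVec x)

open Classical in
/-- The probability, over uniformly random bits, that the estimate for `x` is within a factor
`1 ± ε` of `T`. -/
noncomputable def successProb (A : LinearSketch n) (ε T : ℝ) (x : Fin n → ℤ) : ℝ :=
  (Finset.card {ω : Fin A.seedBits → Bool |
    (1 - ε) * T ≤ A.estimate ω x ∧ A.estimate ω x ≤ (1 + ε) * T} : ℝ) / 2 ^ A.seedBits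

end LinearSketch

/-! It suffices to reach additive error `ε' * ‖x‖_p ^ p`. Write `λ = log n / ε`. The domination
hypothesis gives `‖x‖_p ^ p ≤ 2 * λ ^ c' * topMoment` for a natural number `c' ≥ c`, so `ε' = ε / (2
* λ ^ c')` yields relative error `ε`, at the price of a power of `λ` in space.

For the additive error, the top-`k` moment is a layer-cake sum of `min k (N m)` against the
increments of `t m ^ p`, where `N m` counts the entries of size at least `t m` and the `t m` grow
geometrically. Approximate counts are enough, because `min k` is monotone and 1-Lipschitz. To
estimate `N m`, indices are sampled at each rate `2 ^ (-j)`, every sample is hashed with signs into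
`B` buckets, `L` times over, and a sampled index is detected if all `L` of its counters are large. A
false detection needs noise in all repetitions, which is rare enough for a union bound over all
indices and levels. A missed detection needs noise in only one, but it matters only for the `O(K)`
sampled heavy indices of one suitable level. Second moments control everything, so pairwise
independent affine hashing suffices and the seed is short (`unifProb_heavyCount_bad_le`).

The counters of level `j` resolve the threshold `t` when `‖x‖_2 ^ 2 / 2 ^ j` is small against `B * t
^ 2`, up to powers of the parameter `Q`. Otherwise the estimate is still capped at `4 * K * 2 ^ j`.
Since `‖x‖_2 ^ 2 ≤ n ^ (1 - 2 / p) * ‖x‖_p ^ 2`, a number `B` of order `n ^ (1 - 2 / p)` times a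
power of `Q` makes the cap times `t ^ p` negligible against `‖x‖_p ^ p` (`cap_le_of_noisy`). This is
where the space bound comes from. -/

/-- The probability of an event under the uniform distribution on a finite type. -/
noncomputable def unifProb {Ω : Type*} [Fintype Ω] (S : Ω → Prop) : ℝ :=
  (Nat.card {ω // S ω} : ℝ) / Fintype.card Ω

/-! ### Elementary probability on finite uniform spaces -/

section UniformProbability

variable {Ω α β : Type*} [Fintype Ω] [Fintype α] [Fintype β]

theorem unifProb_eq_card (S : Ω → Prop) [DecidablePred S] :
    unifProb S = ((Finset.univ.filter S).card : ℝ) / Fintype.card Ω := by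
  rw [unifProb, Nat.card_eq_fintype_card, Fintype.card_subtype]

theorem unifProb_eq_sum (S : Ω → Prop) [DecidablePred S] :
    unifProb S = (∑ ω, if S ω then (1 : ℝ) else 0) / Fintype.card Ω := by
  rw [unifProb_eq_card, Finset.sum_boole]

theorem unifProb_mono {S T : Ω → Prop} (h : ∀ ω, S ω → T ω) : unifProb S ≤ unifProb T := by
  classical
  rw [unifProb_eq_card, unifProb_eq_card]
  gcongr with ω
  exact h ω

theorem unifProb_nonneg (S : Ω → Prop) : 0 ≤ unifProb S := by
  unfold unifProb; positivity

theorem unifProb_eq_zero {S : Ω → Prop} (h : ∀ ω, ¬ S ω) : unifProb S = 0 := by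
  classical
  rw [unifProb_eq_card, Finset.filter_false_of_mem (fun ω _ => h ω)]
  simp

theorem unifProb_or_le (S T : Ω → Prop) :
    unifProb (fun ω => S ω ∨ T ω) ≤ unifProb S + unifProb T := by
  classical
  rw [unifProb_eq_card, unifProb_eq_card, unifProb_eq_card, ← add_div, Finset.filter_or]
  gcongr
  exact_mod_cast Finset.card_union_le _ _

theorem unifProb_exists_le {ι : Type*} (s : Finset ι) (S : ι → Ω → Prop) :
    unifProb (fun ω => ∃ i ∈ s, S i ω) ≤ ∑ i ∈ s, unifProb (S i) := by
  classical
  induction s using Finset.induction_on with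
  | empty => simp [unifProb_eq_zero]
  | insert a s ha ih =>
    rw [Finset.sum_insert ha]
    refine le_trans (unifProb_mono (T := fun ω => S a ω ∨ ∃ i ∈ s, S i ω) ?_)
      ((unifProb_or_le _ _).trans (by gcongr))
    intro ω
    simp

/-- Union bound with the same bound for every event. -/
theorem unifProb_exists_le_card_mul {ι : Type*} (s : Finset ι) (S : ι → Ω → Prop) {a : ℝ}
    (h : ∀ i ∈ s, unifProb (S i) ≤ a) :
    unifProb (fun ω => ∃ i ∈ s, S i ω) ≤ s.card * a := by
  refine (unifProb_exists_le s S).trans ?_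
  simpa using Finset.sum_le_sum h

theorem unifProb_not [Nonempty Ω] (S : Ω → Prop) : unifProb (fun ω => ¬ S ω) = 1 - unifProb S := by
  classical
  have h : (Fintype.card Ω : ℝ) ≠ 0 := by exact_mod_cast Fintype.card_ne_zero
  rw [unifProb_eq_card, unifProb_eq_card, eq_sub_iff_add_eq, ← add_div, div_eq_one_iff_eq h]
  rw [add_comm, ← Finset.card_univ]
  exact_mod_cast Finset.card_filter_add_card_filter_not (s := (Finset.univ : Finset Ω)) S

/-- Markov's inequality. -/
theorem unifProb_le_of_sum_le {f : Ω → ℝ} (hf : ∀ ω, 0 ≤ f ω) {a b : ℝ} (ha : 0 < a)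
    (hb : 0 ≤ b) (h : ∑ ω, f ω ≤ Fintype.card Ω * (a * b)) :
    unifProb (fun ω => a ≤ f ω) ≤ b := by
  classical
  rw [unifProb_eq_sum]
  refine div_le_of_le_mul₀ (by positivity) hb ?_
  have : a * (∑ ω, if a ≤ f ω then (1 : ℝ) else 0) ≤ ∑ ω, f ω := by
    rw [Finset.mul_sum]
    refine Finset.sum_le_sum fun ω _ => ?_
    split_ifs with hω
    · simpa using hω
    · simpa using hf ω
  nlinarith

/-- If the first coordinate is good up to probability `a`, and for every good first coordinate the
event has probability at most `b` over the second one, then it has probability at most `a + b`. -/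
theorem unifProb_prod_le [Nonempty α] [Nonempty β] (G : α → Prop) (S : α → β → Prop) {a b : ℝ}
    (hb : 0 ≤ b) (hG : unifProb (fun u => ¬ G u) ≤ a) (hS : ∀ u, G u → unifProb (S u) ≤ b) :
    unifProb (fun ω : α × β => S ω.1 ω.2) ≤ a + b := by
  classical
  have hα : (0 : ℝ) < Fintype.card α := by exact_mod_cast Fintype.card_pos
  have hβ : (0 : ℝ) < Fintype.card β := by exact_mod_cast Fintype.card_pos
  have key : unifProb (fun ω : α × β => S ω.1 ω.2) = (∑ u, unifProb (S u)) / Fintype.card α := by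
    rw [unifProb_eq_sum, Fintype.sum_prod_type]
    simp only [unifProb_eq_sum]
    rw [← Finset.sum_div, div_div, Fintype.card_prod]
    push_cast
    rw [mul_comm (Fintype.card α : ℝ)]
  have hle : ∀ u, unifProb (S u) ≤ (if ¬ G u then (1 : ℝ) else 0) + b := by
    intro u
    by_cases hu : G u
    · simpa [hu] using hS u hu
    · have h1 := unifProb_not (S u)
      have h2 := unifProb_nonneg (fun v => ¬ S u v)
      simp only [hu, not_false_eq_true, if_true]
      linarith
  rw [key]
  rw [unifProb_eq_sum] at hG
  have := Finset.sum_le_sum (s := Finset.univ) fun u _ => hle u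
  rw [Finset.sum_add_distrib] at this
  rw [div_le_iff₀ hα] at hG ⊢
  simp only [Finset.sum_const, Finset.card_univ, nsmul_eq_mul] at this
  rw [add_mul, mul_comm b]
  exact this.trans (add_le_add_left hG _)

theorem unifProb_pi_forall (L : ℕ) (S : Ω → Prop) :
    unifProb (fun ω : Fin L → Ω => ∀ l, S (ω l)) = unifProb S ^ L := by
  classical
  rw [unifProb_eq_card, unifProb_eq_card, div_pow]
  have : (Finset.univ.filter fun ω : Fin L → Ω => ∀ l, S (ω l)) =
      Fintype.piFinset fun _ => Finset.univ.filter S := by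
    ext ω; simp [Fintype.mem_piFinset]
  rw [this, Fintype.card_piFinset_const]
  simp

theorem unifProb_pi_eval [Nonempty Ω] (L : ℕ) (l : Fin L) (S : Ω → Prop) :
    unifProb (fun ω : Fin L → Ω => S (ω l)) = unifProb S := by
  classical
  have h : (Fintype.card Ω : ℝ) ≠ 0 := by exact_mod_cast Fintype.card_ne_zero
  rw [unifProb_eq_card, unifProb_eq_card]
  have : (Finset.univ.filter fun ω : Fin L → Ω => S (ω l)) =
      Fintype.piFinset (Function.update (fun _ => Finset.univ) l (Finset.univ.filter S)) := by
    ext ω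
    simp only [Finset.mem_filter, Finset.mem_univ, true_and, Fintype.mem_piFinset]
    constructor
    · intro hω l'
      by_cases hl : l' = l
      · subst hl; simpa using hω
      · simp [hl]
    · intro hω
      simpa using hω l
  obtain ⟨L, rfl⟩ : ∃ L', L = L' + 1 := ⟨L - 1, by have := l.2; omega⟩
  rw [this, Fintype.card_piFinset]
  have h2 : ∀ l', (Function.update (fun _ => Finset.univ) l (Finset.univ.filter S) l' :
      Finset Ω).card = Function.update (fun _ => Fintype.card Ω) l
        (Finset.univ.filter S).card l' := by
    intro l'
    by_cases hl : l' = l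
    · subst hl; simp
    · simp [hl]
  rw [Finset.prod_congr rfl fun l' _ => h2 l', Finset.prod_update_of_mem (Finset.mem_univ l)]
  rw [Finset.prod_const, Finset.card_sdiff, Fintype.card_fun]
  simp only [Finset.inter_univ, Finset.card_singleton, Finset.card_univ, Fintype.card_fin,
    Nat.add_sub_cancel]
  push_cast
  rw [pow_succ, mul_comm, mul_div_mul_left _ _ (pow_ne_zero _ h)]

theorem unifProb_equiv (f : α ≃ β) (S : β → Prop) :
    unifProb (fun u => S (f u)) = unifProb S := by
  rw [unifProb, unifProb, Fintype.card_congr f,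
    Nat.card_congr (f.subtypeEquiv (p := fun u => S (f u)) (q := S) fun _ => Iff.rfl)]

end UniformProbability

/-! ### Second moments under pairwise independent hashing -/

section PairwiseHash

variable {F ι β : Type*} [Field F]

/-- The pairwise independent hash functions `i ↦ ω₁ e(i) + ω₂` into a finite field. -/
def affineHash (e : ι → F) (ω : F × F) (i : ι) : F := ω.1 * e i + ω.2

section Bucket

variable [DecidableEq ι] [DecidableEq β]

/-- The signed sum of the entries that share the bucket of `i`, without `i` itself. The first
component of `ρ` is the seed of the buckets, the second one the seed of the signs. -/
def bucketNoise (e : ι → F) (bk : F → β) (sg : F → ℤ) (A : Finset ι) (x : ι → ℤ)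
    (ρ : (F × F) × (F × F)) (i : ι) : ℤ :=
  ∑ j ∈ A.erase i with bk (affineHash e ρ.1 j) = bk (affineHash e ρ.1 i),
    sg (affineHash e ρ.2 j) * x j

/-- The counter of bucket `b`. -/
def bucketSum (e : ι → F) (bk : F → β) (sg : F → ℤ) (A : Finset ι) (x : ι → ℤ)
    (ρ : (F × F) × (F × F)) (b : β) : ℤ :=
  ∑ j ∈ A with bk (affineHash e ρ.1 j) = b, sg (affineHash e ρ.2 j) * x j

theorem bucketSum_eq_add_bucketNoise (e : ι → F) (bk : F → β) (sg : F → ℤ) (A : Finset ι)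
    (x : ι → ℤ) (ρ : (F × F) × (F × F)) {i : ι} (hi : i ∈ A) :
    bucketSum e bk sg A x ρ (bk (affineHash e ρ.1 i)) =
      sg (affineHash e ρ.2 i) * x i + bucketNoise e bk sg A x ρ i := by
  rw [bucketSum, bucketNoise, ← Finset.add_sum_erase _ _ (a := i) (by simp [hi])]
  rw [Finset.filter_erase]

/-- The unknown random sign of the entry disappears on taking absolute values, so only the noise
remains as error. -/
theorem abs_abs_bucketSum_sub_abs_le (e : ι → F) (bk : F → β) (sg : F → ℤ)
    (hsg : ∀ u, |sg u| = 1) (A : Finset ι)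
    (x : ι → ℤ) (ρ : (F × F) × (F × F)) {i : ι} (hi : i ∈ A) :
    |(|bucketSum e bk sg A x ρ (bk (affineHash e ρ.1 i))| - |x i|)| ≤
      |bucketNoise e bk sg A x ρ i| := by
  have h : |x i| = |sg (affineHash e ρ.2 i) * x i| := by rw [abs_mul, hsg, one_mul]
  rw [bucketSum_eq_add_bucketNoise e bk sg A x ρ hi, h]
  refine (abs_abs_sub_abs_le _ _).trans (le_of_eq ?_)
  congr 1; ring

end Bucket

variable [Fintype F]

/-- Pairwise independence: a line over a field is determined by its values at two distinct points,
so the seed and the pair of hash values are in bijection. -/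
theorem sum_affineHash_pair (e : ι → F) {i j : ι} (h : e i ≠ e j) (f : F → F → ℝ) :
    ∑ ω, f (affineHash e ω i) (affineHash e ω j) = ∑ u, ∑ v, f u v := by
  have hinj : Function.Injective fun ω : F × F => (affineHash e ω i, affineHash e ω j) := by
    rintro ⟨a, b⟩ ⟨a', b'⟩ hab
    simp only [affineHash, Prod.mk.injEq] at hab
    have h1 : (a - a') * (e i - e j) = 0 := by linear_combination hab.1 - hab.2
    have h2 : a = a' := by
      rcases mul_eq_zero.mp h1 with h3 | h3
      · exact sub_eq_zero.mp h3
      · exact absurd (sub_eq_zero.mp h3) h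
    subst h2
    simpa using hab.1
  rw [← Fintype.sum_prod_type' f]
  exact Fintype.sum_bijective _ (Finite.injective_iff_bijective.mp hinj) _ _ fun _ => rfl

theorem sum_affineHash (e : ι → F) (i : ι) (f : F → ℝ) :
    ∑ ω, f (affineHash e ω i) = Fintype.card F * ∑ u, f u := by
  rw [Fintype.sum_prod_type]
  have : ∀ a : F, ∑ b, f (affineHash e (a, b) i) = ∑ u, f u := fun a =>
    Equiv.sum_comp (Equiv.addLeft (a * e i)) f
  simp [this]

/-- The second moment of a sum of centered functions of the hash values. -/
theorem sum_sq_affineHash (e : ι → F) (he : Function.Injective e) (H : Finset ι) (z : ι → F → ℝ)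
    (hz : ∀ i ∈ H, ∑ u, z i u = 0) :
    ∑ ω, (∑ i ∈ H, z i (affineHash e ω i)) ^ 2 =
      Fintype.card F * ∑ i ∈ H, ∑ u, z i u ^ 2 := by
  classical
  simp only [sq, Finset.sum_mul_sum]
  rw [Finset.sum_comm, Finset.mul_sum]
  refine Finset.sum_congr rfl fun i hi => ?_
  rw [Finset.sum_comm, Finset.sum_eq_single_of_mem i hi]
  · exact sum_affineHash e i fun u => z i u * z i u
  · intro j hj hij
    rw [sum_affineHash_pair e (fun h => hij (he h).symm) fun u v => z i u * z j v]
    simp [← Finset.mul_sum, hz j hj]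

section Sample

variable [DecidableEq F]

/-- The indices whose hash value lies in `P`. -/
def hashSample [Fintype ι] (e : ι → F) (P : Finset F) (ω : F × F) : Finset ι :=
  Finset.univ.filter fun i => affineHash e ω i ∈ P

theorem sum_hashSample [Fintype ι] (e : ι → F) (P : Finset F) (f : ι → ℝ) :
    ∑ ω, ∑ i ∈ hashSample e P ω, f i = Fintype.card F * P.card * ∑ i, f i := by
  simp only [hashSample, Finset.sum_filter]
  rw [Finset.sum_comm, Finset.mul_sum]
  refine Finset.sum_congr rfl fun i _ => ?_
  rw [sum_affineHash e i fun u => if u ∈ P then f i else 0]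
  simp [mul_assoc]

/-- The variance of a sum of pairwise independent indicators; each has variance at most its mean
`P.card / Fintype.card F`. -/
theorem sum_sq_card_inter_hashSample_le [Fintype ι] [DecidableEq ι] (e : ι → F)
    (he : Function.Injective e) (P : Finset F) (H : Finset ι) :
    ∑ ω, (((H ∩ hashSample e P ω).card : ℝ) - P.card / Fintype.card F * H.card) ^ 2 ≤
      Fintype.card F * (P.card * H.card) := by
  have hF : (Fintype.card F : ℝ) ≠ 0 := by exact_mod_cast Fintype.card_ne_zero
  have hF' : (0 : ℝ) < Fintype.card F := by exact_mod_cast Fintype.card_pos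
  set r : ℝ := P.card / Fintype.card F with hr
  have h1 : ∀ ω, (((H ∩ hashSample e P ω).card : ℝ) - r * H.card) =
      ∑ i ∈ H, ((if affineHash e ω i ∈ P then (1 : ℝ) else 0) - r) := by
    intro ω
    rw [Finset.sum_sub_distrib, Finset.sum_boole]
    simp only [Finset.sum_const, nsmul_eq_mul]
    rw [mul_comm r]
    congr 3
    ext i
    simp [hashSample]
  have hs : ∑ u, (if u ∈ P then (1 : ℝ) else 0) = P.card := by simp
  simp only [h1]
  rw [sum_sq_affineHash e he H (fun _ u => (if u ∈ P then (1 : ℝ) else 0) - r)]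
  · have h2 : ∑ u, ((if u ∈ P then (1 : ℝ) else 0) - r) ^ 2 ≤ P.card := by
      have : ∀ u, ((if u ∈ P then (1 : ℝ) else 0) - r) ^ 2 =
          (1 - 2 * r) * (if u ∈ P then (1 : ℝ) else 0) + r ^ 2 := by
        intro u; split_ifs <;> ring
      simp only [this]
      rw [Finset.sum_add_distrib, ← Finset.mul_sum, hs]
      simp only [Finset.sum_const, Finset.card_univ, nsmul_eq_mul]
      have h3 : (Fintype.card F : ℝ) * r ^ 2 = P.card * r := by rw [hr]; field_simp
      rw [h3]
      have : 0 ≤ P.card * r := by positivity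
      linarith
    simp only [Finset.sum_const, nsmul_eq_mul]
    rw [mul_comm (P.card : ℝ)]
    gcongr
  · intro i _
    rw [Finset.sum_sub_distrib, hs]
    simp only [Finset.sum_const, Finset.card_univ, nsmul_eq_mul]
    rw [hr]; field_simp; ring

end Sample

variable [DecidableEq ι] [DecidableEq β]

/-- For fixed buckets the balanced signs remove all cross terms. Averaging over the buckets then
multiplies each square by the collision probability `1 / Fintype.card β`. -/
theorem sum_sq_bucketNoise_le [Fintype β] (e : ι → F) (he : Function.Injective e) (bk : F → β)
    (hbk : ∀ b, (Finset.univ.filter fun u => bk u = b).card * Fintype.card β = Fintype.card F)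
    (sg : F → ℤ) (hsg : ∀ u, |sg u| = 1) (hsg0 : ∑ u, sg u = 0) (A : Finset ι) (x : ι → ℤ)
    (i : ι) :
    ∑ ρ, (bucketNoise e bk sg A x ρ i : ℝ) ^ 2 * Fintype.card β ≤
      Fintype.card ((F × F) × (F × F)) * ∑ j ∈ A, (x j : ℝ) ^ 2 := by
  have hsq : ∀ u, (sg u : ℝ) ^ 2 = 1 := fun u => by
    have : (sg u) ^ 2 = 1 := by rw [← sq_abs, hsg]; norm_num
    exact_mod_cast this
  have hsg0' : ∑ u, (sg u : ℝ) = 0 := by exact_mod_cast hsg0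
  rw [← Finset.sum_mul, Fintype.sum_prod_type]
  have h1 : ∀ a : F × F, ∑ s, (bucketNoise e bk sg A x (a, s) i : ℝ) ^ 2 =
      (Fintype.card F : ℝ) ^ 2 * ∑ j ∈ A.erase i,
        if bk (affineHash e a j) = bk (affineHash e a i) then (x j : ℝ) ^ 2 else 0 := by
    intro a
    have := sum_sq_affineHash e he
      ((A.erase i).filter fun j => bk (affineHash e a j) = bk (affineHash e a i))
      (fun j u => (sg u : ℝ) * x j) (fun j _ => by rw [← Finset.sum_mul, hsg0', zero_mul])
    simp only [bucketNoise, Int.cast_sum, Int.cast_mul]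
    rw [this, Finset.sum_filter, sq, mul_assoc]
    congr 1
    rw [Finset.mul_sum]
    refine Finset.sum_congr rfl fun j _ => ?_
    split_ifs
    · simp [mul_pow, hsq]
    · simp
  have h2 : ∀ j ∈ A.erase i, (∑ a : F × F,
      if bk (affineHash e a j) = bk (affineHash e a i) then (x j : ℝ) ^ 2 else 0) *
        Fintype.card β = (Fintype.card F : ℝ) ^ 2 * (x j : ℝ) ^ 2 := by
    intro j hj
    rw [sum_affineHash_pair e (fun h => (Finset.ne_of_mem_erase hj) (he h))
      fun u v => if bk u = bk v then (x j : ℝ) ^ 2 else 0, Finset.sum_comm, Finset.sum_mul]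
    have : ∀ v, (∑ u, if bk u = bk v then (x j : ℝ) ^ 2 else 0) * Fintype.card β =
        Fintype.card F * (x j : ℝ) ^ 2 := by
      intro v
      rw [← Finset.sum_filter, Finset.sum_const, nsmul_eq_mul, ← hbk (bk v)]
      push_cast; ring
    simp [this]; ring
  simp only [h1]
  rw [← Finset.mul_sum, Finset.sum_comm, mul_assoc, Finset.sum_mul, Finset.sum_congr rfl h2,
    ← Finset.mul_sum]
  simp only [Fintype.card_prod, Nat.cast_mul]
  have : ∑ j ∈ A.erase i, (x j : ℝ) ^ 2 ≤ ∑ j ∈ A, (x j : ℝ) ^ 2 :=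
    Finset.sum_le_sum_of_subset_of_nonneg (Finset.erase_subset _ _) fun _ _ _ => by positivity
  calc _ ≤ (Fintype.card F : ℝ) ^ 2 * ((Fintype.card F : ℝ) ^ 2 * ∑ j ∈ A, (x j : ℝ) ^ 2) := by
        gcongr
    _ = _ := by ring

theorem unifProb_le_abs_bucketNoise_le [Fintype β] [Nonempty β] (e : ι → F)
    (he : Function.Injective e) (bk : F → β)
    (hbk : ∀ b, (Finset.univ.filter fun u => bk u = b).card * Fintype.card β = Fintype.card F)
    (sg : F → ℤ) (hsg : ∀ u, |sg u| = 1) (hsg0 : ∑ u, sg u = 0) (A : Finset ι) (x : ι → ℤ)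
    (i : ι) {γ τ : ℝ} (hγ : 0 < γ) (hτ : 0 ≤ τ)
    (hA : ∑ j ∈ A, (x j : ℝ) ^ 2 ≤ τ * (Fintype.card β * γ ^ 2)) :
    unifProb (fun ρ => γ ≤ |(bucketNoise e bk sg A x ρ i : ℝ)|) ≤ τ := by
  have hβ : (0 : ℝ) < Fintype.card β := by exact_mod_cast Fintype.card_pos
  refine (unifProb_mono (T := fun ρ => Fintype.card β * γ ^ 2 ≤
    (bucketNoise e bk sg A x ρ i : ℝ) ^ 2 * Fintype.card β) ?_).trans
    (unifProb_le_of_sum_le (fun ρ => by positivity) (by positivity) hτ ?_)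
  · intro ρ h
    rw [mul_comm]
    refine mul_le_mul_of_nonneg_right ?_ hβ.le
    rw [← sq_abs (bucketNoise e bk sg A x ρ i : ℝ)]
    exact pow_le_pow_left₀ hγ.le h 2
  · refine (sum_sq_bucketNoise_le e he bk hbk sg hsg hsg0 A x i).trans ?_
    gcongr
    linarith

end PairwiseHash

/-! ### Cardinalities from subsampled counts -/

section CountEstimate

/-- The estimate of a cardinality from the number `X` of its elements that are seen at sampling
rate `2 ^ (-j)`. It is discarded if `X` is too small, and capped if `X` is too large. -/
def levelEstimate (K j X : ℕ) : ℕ := if j = 0 ∨ K ≤ X then min X (4 * K) * 2 ^ j else 0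

/-- The largest of the estimates for the rates `1, 1 / 2, …, 2 ^ (-J)`. -/
def countEstimate (J K : ℕ) (X : ℕ → ℕ) : ℕ :=
  (Finset.range (J + 1)).sup fun j => levelEstimate K j (X j)

theorem levelEstimate_le_cap (K j X : ℕ) : levelEstimate K j X ≤ 4 * K * 2 ^ j := by
  unfold levelEstimate
  split_ifs
  · gcongr; exact min_le_right _ _
  · exact Nat.zero_le _

/-- Discarding small counts makes this hold at every level: where fewer than `K / 2` elements are
expected, the additive deviation cannot lift the count to `K`; elsewhere the deviation is relative.
-/
theorem levelEstimate_le {K j X Y N : ℕ} {ε : ℝ} (hε0 : 0 ≤ ε) (hε : ε < 1) (hK : 0 < K)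
    (hX : X ≤ Y) (h0 : j = 0 → Y = N)
    (hY : |(Y : ℝ) - N / 2 ^ j| ≤ ε * max ((N : ℝ) / 2 ^ j) (K / 2)) :
    (levelEstimate K j X : ℝ) ≤ (1 + ε) * N := by
  have hK' : (0 : ℝ) < K := by exact_mod_cast hK
  have hN : (0 : ℝ) ≤ N := by positivity
  have hXY : (X : ℝ) ≤ Y := by exact_mod_cast hX
  unfold levelEstimate
  split_ifs with h
  · push_cast
    have hm : min (X : ℝ) (4 * K) ≤ X := min_le_left _ _
    rcases Nat.eq_zero_or_pos j with hj | hj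
    · rw [h0 hj] at hXY
      subst hj
      nlinarith
    · have hKX : (K : ℝ) ≤ X := by exact_mod_cast h.resolve_left hj.ne'
      have h2 : (0 : ℝ) < 2 ^ j := by positivity
      have h3 := (abs_le.mp hY).2
      rcases le_total (K / 2 : ℝ) ((N : ℝ) / 2 ^ j) with h4 | h4
      · rw [max_eq_left h4] at h3
        calc min (X : ℝ) (4 * K) * 2 ^ j ≤ ((1 + ε) * (N / 2 ^ j)) * 2 ^ j := by
              gcongr; linarith
          _ = (1 + ε) * N := by field_simp
      · rw [max_eq_right h4] at h3
        nlinarith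
  · push_cast; positivity

/-- The expected count lies between `2 * K` and `4 * K` (for `j = 0` only the upper bound is
needed), so a count off by a factor `1 - ε ≥ 1 / 2` is not discarded, and the cap costs nothing. -/
theorem le_levelEstimate {K j X Y N : ℕ} {ε : ℝ} (hε0 : 0 ≤ ε) (hε : ε ≤ 1 / 2)
    (hX : Y ≤ X) (h0 : j = 0 → Y = N) (hN : N ≤ 4 * K * 2 ^ j)
    (hj : j = 0 ∨ 2 * K * 2 ^ j ≤ N)
    (hY : |(Y : ℝ) - N / 2 ^ j| ≤ ε * max ((N : ℝ) / 2 ^ j) (K / 2)) :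
    (1 - ε) * N ≤ (levelEstimate K j X : ℝ) := by
  have hN0 : (0 : ℝ) ≤ N := by positivity
  have hK0 : (0 : ℝ) ≤ K := by positivity
  have hXY : (Y : ℝ) ≤ X := by exact_mod_cast hX
  have hN' : (N : ℝ) ≤ 4 * K * 2 ^ j := by exact_mod_cast hN
  rcases Nat.eq_zero_or_pos j with hj0 | hj0
  · have := h0 hj0
    subst hj0
    rw [this] at hXY
    rw [levelEstimate, if_pos (Or.inl rfl)]
    push_cast
    have : (N : ℝ) ≤ min (X : ℝ) (4 * K) := le_min hXY (by simpa using hN')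
    nlinarith
  · have h2 : (0 : ℝ) < 2 ^ j := by positivity
    have h3 : (2 * K * 2 ^ j : ℝ) ≤ N := by exact_mod_cast hj.resolve_left hj0.ne'
    have h4 : 2 * (K : ℝ) ≤ N / 2 ^ j := by rwa [le_div_iff₀ h2]
    have h5 : (N : ℝ) / 2 ^ j ≤ 4 * K := by rwa [div_le_iff₀ h2]
    rw [max_eq_left (by linarith)] at hY
    have h6 := (abs_le.mp hY).1
    have h7 : (1 - ε) * (N / 2 ^ j) ≤ X := by linarith
    have h8 : K ≤ X := by
      have : (K : ℝ) ≤ X := by nlinarith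
      exact_mod_cast this
    rw [levelEstimate, if_pos (Or.inr h8)]
    push_cast
    have h9 : (1 - ε) * (N / 2 ^ j) ≤ min (X : ℝ) (4 * K) := le_min h7 (by nlinarith)
    calc (1 - ε) * N = (1 - ε) * (N / 2 ^ j) * 2 ^ j := by field_simp
      _ ≤ _ := by gcongr

theorem exists_sampling_level {J K N : ℕ} (hK : 0 < K) (hN : N ≤ 2 ^ J) :
    ∃ j ≤ J, N ≤ 4 * K * 2 ^ j ∧ (j = 0 ∨ 2 * K * 2 ^ j ≤ N) := by
  classical
  have hJ : N ≤ 4 * K * 2 ^ J := hN.trans (Nat.le_mul_of_pos_left _ (by omega))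
  have hex : ∃ j, N ≤ 4 * K * 2 ^ j := ⟨J, hJ⟩
  -- Minimality of `j` turns failure of the upper bound at `j - 1` into the lower bound at `j`.
  refine ⟨Nat.find hex, Nat.find_min' hex hJ, Nat.find_spec hex, ?_⟩
  rcases h : Nat.find hex with _ | j
  · exact Or.inl rfl
  · right
    have := Nat.find_min hex (m := j) (by omega)
    rw [pow_succ]
    push Not at this
    calc 2 * K * (2 ^ j * 2) = 4 * K * 2 ^ j := by ring
      _ ≤ N := this.le

theorem countEstimate_le {J K : ℕ} {X : ℕ → ℕ} {a : ℝ} (ha : 0 ≤ a)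
    (h : ∀ j ≤ J, (levelEstimate K j (X j) : ℝ) ≤ a) : (countEstimate J K X : ℝ) ≤ a := by
  have : countEstimate J K X ≤ ⌊a⌋₊ := Finset.sup_le fun j hj =>
    Nat.le_floor (h j (by simpa [Nat.lt_succ_iff] using hj))
  exact (Nat.cast_le.mpr this).trans (Nat.floor_le ha)

theorem le_countEstimate {J K j : ℕ} (X : ℕ → ℕ) (hj : j ≤ J) :
    levelEstimate K j (X j) ≤ countEstimate J K X :=
  Finset.le_sup (f := fun j => levelEstimate K j (X j)) (by simpa [Nat.lt_succ_iff] using hj)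

end CountEstimate

/-! ### Detection of heavy entries -/

section Detection

variable {F ι β : Type*} [Field F] [DecidableEq F] [Fintype ι] [DecidableEq ι]
  [DecidableEq β]

/-- The indices of the entries of absolute value at least `t`. -/
noncomputable def heavySet (x : ι → ℤ) (t : ℝ) : Finset ι :=
  Finset.univ.filter fun i => t ≤ |(x i : ℝ)|

/-- The sampled indices whose counter is at least `θ` in absolute value in all the repetitions. -/
noncomputable def detected {L : ℕ} (e : ι → F) (bk : F → β) (P : Finset F) (s : F × F)
    (ρ : Fin L → (F × F) × (F × F)) (y : Fin L → β → ℤ) (θ : ℝ) : Finset ι :=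
  (hashSample e P s).filter fun i => ∀ l, θ ≤ |(y l (bk (affineHash e (ρ l).1 i)) : ℝ)|

variable {L : ℕ} (e : ι → F) (bk : F → β) (sg : F → ℤ) (P : Finset F)
  (s : F × F) (ρ : Fin L → (F × F) × (F × F)) (x : ι → ℤ)

theorem abs_real_bucketSum_bounds {F ι β : Type*} [Field F] [DecidableEq ι]
    [DecidableEq β] (e : ι → F) (bk : F → β) (sg : F → ℤ) (hsg : ∀ u, |sg u| = 1)
    (A : Finset ι) (x : ι → ℤ) (ρ : (F × F) × (F × F)) {i : ι} (hi : i ∈ A) :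
    |(bucketSum e bk sg A x ρ (bk (affineHash e ρ.1 i)) : ℝ)| ≤
        |(x i : ℝ)| + |(bucketNoise e bk sg A x ρ i : ℝ)| ∧
      |(x i : ℝ)| ≤ |(bucketSum e bk sg A x ρ (bk (affineHash e ρ.1 i)) : ℝ)| +
        |(bucketNoise e bk sg A x ρ i : ℝ)| := by
  have h := abs_le.mp (abs_abs_bucketSum_sub_abs_le e bk sg hsg A x ρ hi)
  constructor
  · have := h.2
    rw [sub_le_iff_le_add'] at this
    exact_mod_cast this
  · have := h.1
    rw [neg_le_sub_iff_le_add] at this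
    exact_mod_cast this

/-- A false detection forces the noise to reach `γ` in every repetition; hence one quiet repetition
per index is all that is required. -/
theorem detected_subset (hsg : ∀ u, |sg u| = 1) {t γ : ℝ}
    (h : ∀ i ∈ hashSample e P s, ¬ ∀ l, γ ≤
      |(bucketNoise e bk sg (hashSample e P s) x (ρ l) i : ℝ)|) :
    detected e bk P s ρ (fun l => bucketSum e bk sg (hashSample e P s) x (ρ l)) (t + γ) ⊆
      heavySet x t ∩ hashSample e P s := by
  intro i hi
  rw [detected, Finset.mem_filter] at hi
  refine Finset.mem_inter.mpr ⟨?_, hi.1⟩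
  rw [heavySet, Finset.mem_filter]
  refine ⟨Finset.mem_univ _, ?_⟩
  by_contra hx
  refine h i hi.1 fun l => ?_
  have h1 := hi.2 l
  have h2 := (abs_real_bucketSum_bounds e bk sg hsg _ x (ρ l) hi.1).1
  push Not at hx
  linarith

/-- Here every repetition has to be quiet, but only for the sampled heavy indices. -/
theorem subset_detected (hsg : ∀ u, |sg u| = 1) {t t' γ : ℝ}
    (ht : t + γ ≤ t' - γ)
    (h : ∀ i ∈ heavySet x t' ∩ hashSample e P s, ¬ ∃ l, γ ≤
      |(bucketNoise e bk sg (hashSample e P s) x (ρ l) i : ℝ)|) :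
    heavySet x t' ∩ hashSample e P s ⊆
      detected e bk P s ρ (fun l => bucketSum e bk sg (hashSample e P s) x (ρ l)) (t + γ) := by
  intro i hi
  have hi' := Finset.mem_inter.mp hi
  rw [detected, Finset.mem_filter]
  refine ⟨hi'.2, fun l => ?_⟩
  have h1 : t' ≤ |(x i : ℝ)| := by simpa [heavySet] using hi'.1
  have h2 := (abs_real_bucketSum_bounds e bk sg hsg _ x (ρ l) hi'.2).2
  have h3 := h i hi
  push Not at h3
  linarith [h3 l]

end Detection

/-! ### Concentration of the samples -/

section SamplingBounds

variable {F : Type*} [Field F] [Fintype F] [DecidableEq F] {n : ℕ}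

/-- A sample of rate `2 ^ (-j)` hits every set in about the expected number of indices. -/
theorem unifProb_card_inter_hashSample_deviation_le (e : Fin n → F) (he : Function.Injective e)
    (P : Finset F) (j : ℕ) (hP : P.card * 2 ^ j = Fintype.card F) (H : Finset (Fin n))
    {K : ℕ} (hK : 0 < K) {ε : ℝ} (hε : 0 < ε) :
    unifProb (fun s => ε * max ((H.card : ℝ) / 2 ^ j) (K / 2) ≤
      |((H ∩ hashSample e P s).card : ℝ) - H.card / 2 ^ j|) ≤ 2 / (ε ^ 2 * K) := by
  have hF : (0 : ℝ) < Fintype.card F := by exact_mod_cast Fintype.card_pos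
  have hK' : (0 : ℝ) < K := by exact_mod_cast hK
  have h2 : (0 : ℝ) < 2 ^ j := by positivity
  have hP' : (P.card : ℝ) = Fintype.card F / 2 ^ j := by
    rw [eq_div_iff h2.ne']; exact_mod_cast hP
  have hr : (P.card : ℝ) / Fintype.card F * H.card = H.card / 2 ^ j := by
    rw [hP']; field_simp
  set m : ℝ := max ((H.card : ℝ) / 2 ^ j) (K / 2) with hm
  have hm1 : (H.card : ℝ) / 2 ^ j ≤ m := le_max_left _ _
  have hm2 : (K : ℝ) / 2 ≤ m := le_max_right _ _
  have hm0 : 0 < m := by linarith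
  refine (unifProb_mono (T := fun s => (ε * m) ^ 2 ≤
    (((H ∩ hashSample e P s).card : ℝ) - P.card / Fintype.card F * H.card) ^ 2) ?_).trans
    (unifProb_le_of_sum_le (fun s => sq_nonneg _) (by positivity) (by positivity) ?_)
  · intro s hs
    rw [hr, ← sq_abs (_ - _)]
    exact pow_le_pow_left₀ (by positivity) hs 2
  · refine (sum_sq_card_inter_hashSample_le e he P H).trans ?_
    rw [Fintype.card_prod]
    push_cast
    rw [mul_assoc]
    refine mul_le_mul_of_nonneg_left ?_ hF.le
    have h3 : (ε * m) ^ 2 * (2 / (ε ^ 2 * K)) = m * (m / (K / 2)) := by field_simp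
    have h4 : 1 ≤ m / (K / 2) := by rwa [le_div_iff₀ (by positivity), one_mul]
    rw [h3, hP']
    calc (Fintype.card F : ℝ) / 2 ^ j * H.card = Fintype.card F * (H.card / 2 ^ j) := by ring
      _ ≤ Fintype.card F * (m * (m / (K / 2))) := by
        gcongr
        nlinarith

/-- The mass of a sample of rate `2 ^ (-j)` is not much larger than expected. -/
theorem unifProb_hashSample_mass_le (e : Fin n → F)
    (P : Finset F) (j : ℕ) (hP : P.card * 2 ^ j = Fintype.card F) (f : Fin n → ℝ)
    (hf : ∀ i, 0 ≤ f i) {R : ℝ} (hR : 0 < R) :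
    unifProb (fun s => R * ∑ i, f i < (∑ i ∈ hashSample e P s, f i) * 2 ^ j) ≤ 1 / R := by
  have hF : (0 : ℝ) < Fintype.card F := by exact_mod_cast Fintype.card_pos
  have h2 : (0 : ℝ) < 2 ^ j := by positivity
  have hP' : (P.card : ℝ) * 2 ^ j = Fintype.card F := by exact_mod_cast hP
  have hnn : ∀ s, 0 ≤ ∑ i ∈ hashSample e P s, f i := fun s => Finset.sum_nonneg fun i _ => hf i
  rcases (Finset.sum_nonneg fun i (_ : i ∈ Finset.univ) => hf i).eq_or_lt with h0 | h0
  · rw [unifProb_eq_zero]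
    · positivity
    · intro s
      have h1 : ∑ i ∈ hashSample e P s, f i ≤ ∑ i, f i :=
        Finset.sum_le_sum_of_subset_of_nonneg (Finset.subset_univ _) fun i _ _ => hf i
      rw [← h0] at h1 ⊢
      nlinarith [hnn s]
  · refine (unifProb_mono (T := fun s => R * ∑ i, f i ≤
      (∑ i ∈ hashSample e P s, f i) * 2 ^ j) fun s hs => hs.le).trans
      (unifProb_le_of_sum_le (fun s => mul_nonneg (hnn s) h2.le) (by positivity)
        (by positivity) ?_)
    rw [← Finset.sum_mul, sum_hashSample, Fintype.card_prod]
    push_cast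
    refine le_of_eq ?_
    rw [← hP']
    field_simp

end SamplingBounds

/-! ### Failure probability of the estimated counts -/

section CountBounds

variable {F β : Type*} [Field F] [Fintype F] [Fintype β] [Nonempty β]
  [DecidableEq β] {n L : ℕ}

theorem unifProb_noisy_le (e : Fin n → F) (he : Function.Injective e) (bk : F → β)
    (hbk : ∀ b, (Finset.univ.filter fun u => bk u = b).card * Fintype.card β = Fintype.card F)
    (sg : F → ℤ) (hsg : ∀ u, |sg u| = 1) (hsg0 : ∑ u, sg u = 0) (A : Finset (Fin n))
    (x : Fin n → ℤ) {γ τ : ℝ} (hγ : 0 < γ) (hτ : 0 ≤ τ)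
    (hA : ∑ j ∈ A, (x j : ℝ) ^ 2 ≤ τ * (Fintype.card β * γ ^ 2)) :
    unifProb (fun ρ : Fin L → (F × F) × (F × F) => ∃ i ∈ A,
      ∀ l, γ ≤ |(bucketNoise e bk sg A x (ρ l) i : ℝ)|) ≤ n * τ ^ L := by
  refine (unifProb_exists_le_card_mul A _ (a := τ ^ L) fun i _ => ?_).trans ?_
  · rw [unifProb_pi_forall L fun r => γ ≤ |(bucketNoise e bk sg A x r i : ℝ)|]
    exact pow_le_pow_left₀ (unifProb_nonneg _)
      (unifProb_le_abs_bucketNoise_le e he bk hbk sg hsg hsg0 A x i hγ hτ hA) L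
  · gcongr
    simpa using Finset.card_le_univ A

theorem unifProb_some_noise_le (e : Fin n → F) (he : Function.Injective e) (bk : F → β)
    (hbk : ∀ b, (Finset.univ.filter fun u => bk u = b).card * Fintype.card β = Fintype.card F)
    (sg : F → ℤ) (hsg : ∀ u, |sg u| = 1) (hsg0 : ∑ u, sg u = 0) (A H : Finset (Fin n))
    (x : Fin n → ℤ) {γ τ : ℝ} (hγ : 0 < γ) (hτ : 0 ≤ τ)
    (hA : ∑ j ∈ A, (x j : ℝ) ^ 2 ≤ τ * (Fintype.card β * γ ^ 2)) :
    unifProb (fun ρ : Fin L → (F × F) × (F × F) => ∃ i ∈ H,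
      ∃ l, γ ≤ |(bucketNoise e bk sg A x (ρ l) i : ℝ)|) ≤ H.card * (L * τ) := by
  refine unifProb_exists_le_card_mul H _ (a := L * τ) fun i _ => ?_
  refine (unifProb_mono (T := fun ρ : Fin L → (F × F) × (F × F) => ∃ l ∈ Finset.univ,
    γ ≤ |(bucketNoise e bk sg A x (ρ l) i : ℝ)|) ?_).trans
    ((unifProb_exists_le_card_mul Finset.univ _ (a := τ) fun l _ => ?_).trans ?_)
  · rintro ρ ⟨l, hl⟩; exact ⟨l, Finset.mem_univ _, hl⟩
  · rw [unifProb_pi_eval L l fun r => γ ≤ |(bucketNoise e bk sg A x r i : ℝ)|]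
    exact unifProb_le_abs_bucketNoise_le e he bk hbk sg hsg hsg0 A x i hγ hτ hA
  · simp

variable [DecidableEq F]

/-- The estimate of the number of entries of absolute value about `t`, from counters `y` at all
sampling levels; `θ` is the detection threshold. -/
noncomputable def heavyCount (e : Fin n → F) (bk : F → β) (P : ℕ → Finset F) (J K : ℕ)
    (ω : (F × F) × (Fin L → (F × F) × (F × F))) (y : ℕ → Fin L → β → ℤ) (θ : ℝ) : ℕ :=
  countEstimate J K fun j => (detected e bk (P j) ω.1 ω.2 (y j) θ).card

/-- The counters of all sampling levels. -/
def levelCounters (e : Fin n → F) (bk : F → β) (sg : F → ℤ) (P : ℕ → Finset F) (x : Fin n → ℤ)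
    (ω : (F × F) × (Fin L → (F × F) × (F × F))) (j : ℕ) (l : Fin L) (b : β) : ℤ :=
  bucketSum e bk sg (hashSample e (P j) ω.1) x (ω.2 l) b

/-- A sample seed is good for `x` if, at all levels, the sets of heavy entries are hit about as
often as expected, and the sampled mass is not too large. -/
def GoodSample (e : Fin n → F) (P : ℕ → Finset F) (J M K : ℕ) (ε R : ℝ) (t : ℕ → ℝ)
    (x : Fin n → ℤ) (s : F × F) : Prop :=
  (∀ j ≤ J, ∀ m ≤ M,
    |((heavySet x (t m) ∩ hashSample e (P j) s).card : ℝ) - (heavySet x (t m)).card / 2 ^ j| <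
      ε * max (((heavySet x (t m)).card : ℝ) / 2 ^ j) (K / 2)) ∧
  ∀ j ≤ J, (∑ i ∈ hashSample e (P j) s, (x i : ℝ) ^ 2) * 2 ^ j ≤ R * ∑ i, (x i : ℝ) ^ 2

theorem unifProb_not_goodSample_le (e : Fin n → F) (he : Function.Injective e)
    (P : ℕ → Finset F) {J M K : ℕ} (hP : ∀ j ≤ J, (P j).card * 2 ^ j = Fintype.card F)
    (hK : 0 < K) {ε R : ℝ} (hε : 0 < ε) (hR : 0 < R) (t : ℕ → ℝ) (x : Fin n → ℤ) :
    unifProb (fun s => ¬ GoodSample e P J M K ε R t x s) ≤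
      (J + 1) * (M + 1) * (2 / (ε ^ 2 * K)) + (J + 1) * (1 / R) := by
  refine (unifProb_mono (T := fun s =>
    (∃ a ∈ Finset.range (J + 1) ×ˢ Finset.range (M + 1),
      ε * max (((heavySet x (t a.2)).card : ℝ) / 2 ^ a.1) (K / 2) ≤
      |((heavySet x (t a.2) ∩ hashSample e (P a.1) s).card : ℝ) -
        (heavySet x (t a.2)).card / 2 ^ a.1|) ∨
    ∃ j ∈ Finset.range (J + 1), R * ∑ i, (x i : ℝ) ^ 2 <
      (∑ i ∈ hashSample e (P j) s, (x i : ℝ) ^ 2) * 2 ^ j) ?_).trans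
    ((unifProb_or_le _ _).trans (add_le_add ?_ ?_))
  · intro s hs
    by_contra hcon
    push Not at hcon
    refine hs ⟨fun j hj m hm => hcon.1 (j, m) ?_, fun j hj => hcon.2 j ?_⟩
    · simp only [Finset.mem_product, Finset.mem_range]; omega
    · simp only [Finset.mem_range]; omega
  · refine (unifProb_exists_le_card_mul _ _ (a := 2 / (ε ^ 2 * K))
      fun a ha => ?_).trans (le_of_eq ?_)
    · exact unifProb_card_inter_hashSample_deviation_le e he (P a.1) a.1
        (hP _ (by simp only [Finset.mem_product, Finset.mem_range] at ha; omega)) _ hK hε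
    · simp
  · refine (unifProb_exists_le_card_mul _ _ (a := 1 / R) fun j hj => ?_).trans (le_of_eq ?_)
    · exact unifProb_hashSample_mass_le e (P j) j
        (hP _ (by simp only [Finset.mem_range] at hj; omega)) _ (fun i => sq_nonneg _) hR
    · simp

/-- With high probability all the estimated counts are sandwiched between the true counts for the
next and for the current threshold, up to errors `S m` that account for the levels at which the
counters are too noisy. -/
theorem unifProb_heavyCount_bad_le (e : Fin n → F) (he : Function.Injective e) (bk : F → β)
    (hbk : ∀ b, (Finset.univ.filter fun u => bk u = b).card * Fintype.card β = Fintype.card F)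
    (sg : F → ℤ) (hsg : ∀ u, |sg u| = 1) (hsg0 : ∑ u, sg u = 0)
    (P : ℕ → Finset F) {J M K : ℕ} (hP : ∀ j ≤ J, (P j).card * 2 ^ j = Fintype.card F)
    (hJ : n ≤ 2 ^ J) (hK : 0 < K) {ε R τ : ℝ} (hε : 0 < ε) (hε2 : ε ≤ 1 / 2) (hR : 0 < R)
    (hτ : 0 ≤ τ) (t γ : ℕ → ℝ) (hγ : ∀ m < M, 0 < γ m)
    (htγ : ∀ m < M, t m + γ m ≤ t (m + 1) - γ m) (S : ℕ → ℝ) (hS0 : ∀ m, 0 ≤ S m)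
    (x : Fin n → ℤ)
    (hS : ∀ m < M, ∀ j ≤ J, τ * (Fintype.card β * γ m ^ 2) * 2 ^ j < R * ∑ i, (x i : ℝ) ^ 2 →
      4 * K * 2 ^ j ≤ S m) :
    unifProb (fun ω : (F × F) × (Fin L → (F × F) × (F × F)) => ¬ ∀ m < M,
      (heavyCount e bk P J K ω (levelCounters e bk sg P x ω) (t m + γ m) : ℝ) ≤
          (1 + ε) * (heavySet x (t m)).card + S m ∧
        (1 - ε) * (heavySet x (t (m + 1))).card - S m ≤
          heavyCount e bk P J K ω (levelCounters e bk sg P x ω) (t m + γ m)) ≤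
      ((J + 1) * (M + 1) * (2 / (ε ^ 2 * K)) + (J + 1) * (1 / R)) +
        ((J + 1) * M * (n * τ ^ L) + M * (8 * K * (L * τ))) := by
  classical
  have hH : ∀ H : Finset (Fin n), H.card ≤ 2 ^ J := fun H =>
    (by simpa using Finset.card_le_univ H : H.card ≤ n).trans hJ
  -- The level at which the count for `t (m + 1)` is guaranteed not to be lost; the lower bound
  -- relies on this level alone.
  choose jst hjstJ hjst1 hjst2 using fun m : ℕ =>
    exists_sampling_level hK (hH (heavySet x (t (m + 1))))
  have hP0 : ∀ s, hashSample e (P 0) s = Finset.univ := by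
    intro s
    have h1 : P 0 = Finset.univ := by
      rw [← Finset.card_eq_iff_eq_univ]
      simpa using hP 0 (Nat.zero_le _)
    simp [hashSample, h1]
  -- Level `j` resolves threshold `m`: for a good sample, Chebyshev bounds by `τ` the probability of
  -- noise `γ m` at one index.
  let valid : ℕ → ℕ → Prop := fun m j =>
    R * ∑ i, (x i : ℝ) ^ 2 ≤ τ * (Fintype.card β * γ m ^ 2) * 2 ^ j
  let A : ℕ → F × F → Finset (Fin n) := fun j s => hashSample e (P j) s
  have hεK : (0 : ℝ) < K := by exact_mod_cast hK
  refine unifProb_prod_le (GoodSample e P J M K ε R t x) (fun s ρ => ¬ ∀ m < M,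
      (heavyCount e bk P J K (s, ρ) (levelCounters e bk sg P x (s, ρ)) (t m + γ m) : ℝ) ≤
          (1 + ε) * (heavySet x (t m)).card + S m ∧
        (1 - ε) * (heavySet x (t (m + 1))).card - S m ≤
          heavyCount e bk P J K (s, ρ) (levelCounters e bk sg P x (s, ρ)) (t m + γ m))
    (by positivity) (unifProb_not_goodSample_le e he P hP hK hε hR t x) ?_
  rintro s ⟨hs1, hs2⟩
  have hmass : ∀ m j, j ≤ J → valid m j →
      ∑ i ∈ A j s, (x i : ℝ) ^ 2 ≤ τ * (Fintype.card β * γ m ^ 2) := by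
    intro m j hj hv
    exact le_of_mul_le_mul_right ((hs2 j hj).trans hv) (by positivity)
  refine (unifProb_mono (T := fun ρ : Fin L → (F × F) × (F × F) =>
    (∃ a ∈ (Finset.range (J + 1) ×ˢ Finset.range M).filter (fun a => valid a.2 a.1),
      ∃ i ∈ A a.1 s, ∀ l, γ a.2 ≤ |(bucketNoise e bk sg (A a.1 s) x (ρ l) i : ℝ)|) ∨
    ∃ m ∈ (Finset.range M).filter (fun m => valid m (jst m)),
      ∃ i ∈ heavySet x (t (m + 1)) ∩ A (jst m) s,
        ∃ l, γ m ≤ |(bucketNoise e bk sg (A (jst m) s) x (ρ l) i : ℝ)|) ?_).trans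
    ((unifProb_or_le _ _).trans (add_le_add ?_ ?_))
  · intro ρ hρ
    by_contra hcon
    rw [not_or] at hcon
    refine hρ fun m hm => ⟨?_, ?_⟩
    · refine countEstimate_le (add_nonneg (by positivity) (hS0 m)) fun j hj => ?_
      by_cases hv : valid m j
      · have hsub : detected e bk (P j) s ρ (levelCounters e bk sg P x (s, ρ) j) (t m + γ m) ⊆
            heavySet x (t m) ∩ hashSample e (P j) s := by
          refine detected_subset e bk sg (P j) s ρ x hsg fun i hi hl => hcon.1 ?_
          refine ⟨(j, m), ?_, i, hi, hl⟩
          simp only [Finset.mem_filter, Finset.mem_product, Finset.mem_range]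
          exact ⟨⟨by omega, hm⟩, hv⟩
        have := levelEstimate_le hε.le (by linarith) hK (Finset.card_le_card hsub)
          (fun h0 => by rw [h0, hP0, Finset.inter_univ]) (hs1 j hj m hm.le).le
        linarith [hS0 m]
      -- An unresolved level may report anything, but its cap is absorbed by `S m`.
      · have h1 := hS m hm j hj (not_le.mp hv)
        have h2 : (levelEstimate K j (detected e bk (P j) s ρ
          (levelCounters e bk sg P x (s, ρ) j) (t m + γ m)).card : ℝ) ≤ 4 * K * 2 ^ j := by
          exact_mod_cast levelEstimate_le_cap _ _ _
        have : 0 ≤ (1 + ε) * ((heavySet x (t m)).card : ℝ) := by positivity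
        exact h2.trans (by linarith)
    · by_cases hv : valid m (jst m)
      · have hsub : heavySet x (t (m + 1)) ∩ hashSample e (P (jst m)) s ⊆
            detected e bk (P (jst m)) s ρ (levelCounters e bk sg P x (s, ρ) (jst m))
              (t m + γ m) := by
          refine subset_detected e bk sg (P (jst m)) s ρ x hsg (htγ m hm)
            fun i hi hl => hcon.2 ?_
          refine ⟨m, ?_, i, hi, hl⟩
          simp only [Finset.mem_filter, Finset.mem_range]
          exact ⟨hm, hv⟩
        have h1 := le_levelEstimate hε.le hε2 (Finset.card_le_card hsub)
          (fun h0 => by rw [h0, hP0, Finset.inter_univ]) (hjst1 m) (hjst2 m)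
          (hs1 (jst m) (hjstJ m) (m + 1) hm).le
        have h2 := Nat.cast_le (α := ℝ).mpr (le_countEstimate (K := K) (fun j =>
          (detected e bk (P j) s ρ (levelCounters e bk sg P x (s, ρ) j) (t m + γ m)).card)
          (hjstJ m))
        have h3 := h1.trans h2
        have := hS0 m
        exact (by linarith : _ ≤ (1 - ε) * ((heavySet x (t (m + 1))).card : ℝ)).trans h3
      -- If the chosen level is unresolved, the true count is itself at most `4 * K * 2 ^ jst m ≤ S
      -- m`, so the lower bound is nonpositive.
      · have h1 := hS m hm _ (hjstJ m) (not_le.mp hv)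
        have h2 : ((heavySet x (t (m + 1))).card : ℝ) ≤ 4 * K * 2 ^ (jst m) := by
          exact_mod_cast hjst1 m
        have h3 : (0 : ℝ) ≤ heavyCount e bk P J K (s, ρ)
          (levelCounters e bk sg P x (s, ρ)) (t m + γ m) := by positivity
        have h4 : (0 : ℝ) ≤ (heavySet x (t (m + 1))).card := by positivity
        nlinarith
  · refine (unifProb_exists_le_card_mul _ _ (a := n * τ ^ L) fun a ha => ?_).trans ?_
    · simp only [Finset.mem_filter, Finset.mem_product, Finset.mem_range] at ha
      exact unifProb_noisy_le e he bk hbk sg hsg hsg0 _ x (hγ _ ha.1.2) hτ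
        (hmass _ _ (by omega) ha.2)
    · gcongr
      have := Finset.card_filter_le (Finset.range (J + 1) ×ˢ Finset.range M)
        (fun a => valid a.2 a.1)
      simp only [Finset.card_product, Finset.card_range] at this
      exact_mod_cast this
  · refine (unifProb_exists_le_card_mul _ _ (a := 8 * K * (L * τ)) fun m hm => ?_).trans ?_
    · simp only [Finset.mem_filter, Finset.mem_range] at hm
      refine (unifProb_some_noise_le e he bk hbk sg hsg hsg0 _ _ x (hγ _ hm.1) hτ
        (hmass _ _ (hjstJ m) hm.2)).trans ?_
      gcongr
      -- The expected number of sampled heavy indices is at most `4 * K`, and so is the deviation;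
      -- this is the source of `8 * K`.
      have h1 := (abs_lt.mp (hs1 (jst m) (hjstJ m) (m + 1) hm.1)).2
      have h2 : ((heavySet x (t (m + 1))).card : ℝ) / 2 ^ (jst m) ≤ 4 * K := by
        rw [div_le_iff₀ (by positivity)]
        exact_mod_cast hjst1 m
      have h3 : max (((heavySet x (t (m + 1))).card : ℝ) / 2 ^ (jst m)) (K / 2) ≤ 4 * K :=
        max_le h2 (by linarith)
      have h4 : ε * max (((heavySet x (t (m + 1))).card : ℝ) / 2 ^ (jst m)) (K / 2) ≤
          1 * (4 * K) := mul_le_mul (by linarith) h3 (by positivity) (by norm_num)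
      linarith
    · gcongr
      have := Finset.card_filter_le (Finset.range M) (fun m => valid m (jst m))
      rw [Finset.card_range] at this
      exact this

end CountBounds

/-! ### Layer-cake formula for the moment of the top entries -/

section LayerCake

/-- The increments of `m ↦ t m ^ p`. -/
noncomputable def layerWeight (p : ℝ) (t : ℕ → ℝ) (m : ℕ) : ℝ :=
  t m ^ p - if m = 0 then 0 else t (m - 1) ^ p

/-- The moment of the `k` largest entries, computed from the numbers `N m` of entries of absolute
value at least `t m`. -/
noncomputable def momentEstimate (p : ℝ) (t : ℕ → ℝ) (M k : ℕ) (N : ℕ → ℕ) : ℝ :=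
  ∑ m ∈ Finset.range M, layerWeight p t m * min (k : ℝ) (N m)

variable {p : ℝ} {t : ℕ → ℝ}

theorem layerWeight_nonneg (hp : 0 ≤ p) (ht0 : ∀ m, 0 < t m) (ht : Monotone t) (m : ℕ) :
    0 ≤ layerWeight p t m := by
  unfold layerWeight
  split_ifs
  · have := ht0 m
    rw [sub_zero]; positivity
  · exact sub_nonneg.mpr (Real.rpow_le_rpow (ht0 _).le (ht (Nat.sub_le _ _)) hp)

theorem layerWeight_le (ht0 : ∀ m, 0 < t m) (m : ℕ) : layerWeight p t m ≤ t m ^ p := by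
  unfold layerWeight
  split_ifs
  · simp
  · have := Real.rpow_nonneg (ht0 (m - 1)).le p
    linarith

theorem sum_layerWeight (p : ℝ) (t : ℕ → ℝ) (m : ℕ) :
    ∑ i ∈ Finset.range (m + 1), layerWeight p t i = t m ^ p := by
  induction m with
  | zero => simp [layerWeight]
  | succ m ih => rw [Finset.sum_range_succ, ih]; simp [layerWeight]

/-- The increments telescope up to the last threshold not exceeding `v`. -/
theorem sum_layerWeight_ite_le (hp : 0 ≤ p) (ht0 : ∀ m, 0 < t m) (ht : Monotone t) (M : ℕ)
    {v : ℝ} (hv : 0 ≤ v) :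
    ∑ m ∈ Finset.range M, (if t m ≤ v then layerWeight p t m else 0) ≤ v ^ p := by
  induction M with
  | zero => simpa using Real.rpow_nonneg hv p
  | succ M ih =>
    by_cases h : t M ≤ v
    · rw [Finset.sum_congr rfl fun m hm => if_pos ((ht (by simp at hm; omega)).trans h),
        sum_layerWeight]
      exact Real.rpow_le_rpow (ht0 M).le h hp
    · rw [Finset.sum_range_succ, if_neg h, add_zero]
      exact ih

/-- Two thresholds are lost, whence `t (m + 2)` in `hc`: one in rounding `v` down, one because the
layer `m` is tested at `t (m + 1)`. -/
theorem le_sum_layerWeight_ite {c₀ : ℝ} (hp : 0 ≤ p) (ht : Monotone t)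
    (hc₀ : 0 ≤ c₀) (hc : ∀ m, c₀ * t (m + 2) ^ p ≤ t m ^ p) (M : ℕ) {v : ℝ} (hv : 0 ≤ v)
    (hv1 : t 1 ≤ v) (hv2 : v < t (M + 1)) :
    c₀ * v ^ p ≤ ∑ m ∈ Finset.range M, (if t (m + 1) ≤ v then layerWeight p t m else 0) := by
  induction M with
  | zero => exact absurd hv1 (not_le.mpr hv2)
  | succ M ih =>
    by_cases h : t (M + 1) ≤ v
    · rw [Finset.sum_congr rfl fun m hm => if_pos ((ht (by simp at hm; omega)).trans h),
        sum_layerWeight]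
      refine le_trans ?_ (hc M)
      gcongr
    · rw [Finset.sum_range_succ, if_neg h, add_zero]
      exact ih (not_le.mp h)

variable {n : ℕ}

theorem ranked_abs_antitone (x : Fin n → ℤ) {i j : Fin n} (h : i ≤ j) :
    |ranked x j| ≤ |ranked x i| := by
  have := Tuple.monotone_sort (fun i => -|x i|) h
  simpa [ranked] using this

theorem sum_ranked {α : Type*} [AddCommMonoid α] (x : Fin n → ℤ) (f : ℤ → α) :
    ∑ i, f (ranked x i) = ∑ i, f (x i) :=
  Equiv.sum_comp (Tuple.sort fun i => -|x i|) fun i => f (x i)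

theorem mem_iff_lt_card_of_isLowerSet {D : Finset (Fin n)} (hD : ∀ i j, i ≤ j → j ∈ D → i ∈ D)
    (i : Fin n) : i ∈ D ↔ (i : ℕ) < D.card := by
  constructor
  · intro hi
    have : Finset.Iic i ⊆ D := fun j hj => hD j i (Finset.mem_Iic.mp hj) hi
    have := Finset.card_le_card this
    rw [Fin.card_Iic] at this
    omega
  · intro hi
    by_contra hcon
    have : D ⊆ Finset.Iio i := fun j hj => by
      rw [Finset.mem_Iio]
      by_contra hij
      exact hcon (hD i j (not_lt.mp hij) hj)
    have := Finset.card_le_card this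
    rw [Fin.card_Iio] at this
    omega

/-- The ranks of the heavy entries form an initial segment, so truncating their number at `k` counts
the heavy entries among the top `k`. -/
theorem min_card_heavySet (x : Fin n → ℤ) (k : ℕ) (τ : ℝ) :
    (min (k : ℝ) ((heavySet x τ).card : ℝ)) =
      ∑ i ∈ Finset.univ.filter (fun i : Fin n => (i : ℕ) < k),
        if τ ≤ |(ranked x i : ℝ)| then (1 : ℝ) else 0 := by
  set D : Finset (Fin n) := Finset.univ.filter fun i => τ ≤ |(ranked x i : ℝ)| with hDdef
  have hcard : (heavySet x τ).card = D.card := by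
    rw [heavySet, hDdef, Finset.card_filter, Finset.card_filter]
    exact (sum_ranked x fun z => if τ ≤ |(z : ℝ)| then 1 else 0).symm
  have hD : ∀ i j, i ≤ j → j ∈ D → i ∈ D := by
    intro i j hij hj
    simp only [hDdef, Finset.mem_filter, Finset.mem_univ, true_and] at hj ⊢
    refine hj.trans ?_
    exact_mod_cast ranked_abs_antitone x hij
  have hmem := mem_iff_lt_card_of_isLowerSet hD
  rw [hcard, Finset.sum_boole, Finset.filter_filter]
  have : (Finset.univ.filter fun i : Fin n => (i : ℕ) < k ∧ τ ≤ |(ranked x i : ℝ)|) =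
      Finset.univ.filter fun i : Fin n => (i : ℕ) < min k D.card := by
    ext i
    have := hmem i
    simp only [hDdef, Finset.mem_filter, Finset.mem_univ, true_and] at this ⊢
    rw [this, lt_min_iff]
  rw [this, Fin.card_filter_val_lt, ← Nat.cast_min]
  have : D.card ≤ n := by simpa using Finset.card_le_univ D
  congr 1
  omega

theorem sum_layerWeight_mul_min (x : Fin n → ℤ) (w : ℕ → ℝ) (s : ℕ → ℝ) (M k : ℕ) :
    ∑ m ∈ Finset.range M, w m * min (k : ℝ) ((heavySet x (s m)).card : ℝ) =
      ∑ i ∈ Finset.univ.filter (fun i : Fin n => (i : ℕ) < k),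
        ∑ m ∈ Finset.range M, if s m ≤ |(ranked x i : ℝ)| then w m else 0 := by
  simp only [min_card_heavySet, Finset.mul_sum]
  rw [Finset.sum_comm]
  simp

/-- Truncation by `min k` preserves both the factors `1 ± ε` and the additive errors `S m`, so the
bounds on the counts can be summed over the layers. The condition `t 1 ≤ 1` ensures that every
nonzero integer entry reaches `t 1`. -/
theorem momentEstimate_bounds (hp : 0 ≤ p) (hp0 : p ≠ 0) (ht0 : ∀ m, 0 < t m) (ht : Monotone t)
    (ht1 : t 1 ≤ 1) {c₀ : ℝ}
    (hc₀ : 0 ≤ c₀) (hc : ∀ m, c₀ * t (m + 2) ^ p ≤ t m ^ p) (M k : ℕ) (x : Fin n → ℤ)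
    (hx : ∀ i, |(x i : ℝ)| < t (M + 1)) {ε : ℝ} (hε : 0 ≤ ε) (hε1 : ε ≤ 1) (N : ℕ → ℕ)
    (S : ℕ → ℝ) (hS : ∀ m, 0 ≤ S m)
    (hN : ∀ m < M, (N m : ℝ) ≤ (1 + ε) * (heavySet x (t m)).card + S m ∧
      (1 - ε) * (heavySet x (t (m + 1))).card - S m ≤ N m) :
    momentEstimate p t M k N ≤
        (1 + ε) * topMoment p k x + ∑ m ∈ Finset.range M, t m ^ p * S m ∧
      (1 - ε) * (c₀ * topMoment p k x) - ∑ m ∈ Finset.range M, t m ^ p * S m ≤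
        momentEstimate p t M k N := by
  have hw := layerWeight_nonneg hp ht0 ht
  have hk : (0 : ℝ) ≤ k := by positivity
  have hup : ∑ m ∈ Finset.range M, layerWeight p t m *
      min (k : ℝ) ((heavySet x (t m)).card : ℝ) ≤ topMoment p k x := by
    rw [sum_layerWeight_mul_min]
    exact Finset.sum_le_sum fun i _ => sum_layerWeight_ite_le hp ht0 ht M (abs_nonneg _)
  have hlow : c₀ * topMoment p k x ≤ ∑ m ∈ Finset.range M, layerWeight p t m *
      min (k : ℝ) ((heavySet x (t (m + 1))).card : ℝ) := by
    rw [sum_layerWeight_mul_min x (layerWeight p t) (fun m => t (m + 1)), topMoment,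
      Finset.mul_sum]
    refine Finset.sum_le_sum fun i _ => ?_
    rcases eq_or_ne (ranked x i) 0 with h0 | h0
    · rw [h0]
      simp only [Int.cast_zero, abs_zero, Real.zero_rpow hp0, mul_zero]
      refine Finset.sum_nonneg fun m _ => ?_
      split_ifs
      · exact hw m
      · exact le_rfl
    · have h1 : (1 : ℝ) ≤ |(ranked x i : ℝ)| := by exact_mod_cast Int.one_le_abs h0
      exact le_sum_layerWeight_ite hp ht hc₀ hc M (abs_nonneg _) (ht1.trans h1) (hx _)
  constructor
  · calc momentEstimate p t M k N ≤ ∑ m ∈ Finset.range M, ((1 + ε) * (layerWeight p t m *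
          min (k : ℝ) ((heavySet x (t m)).card : ℝ)) + t m ^ p * S m) := by
          refine Finset.sum_le_sum fun m hm => ?_
          have h1 := (hN m (Finset.mem_range.mp hm)).1
          have h2 : min (k : ℝ) (N m) ≤
              (1 + ε) * min (k : ℝ) ((heavySet x (t m)).card : ℝ) + S m := by
            rcases le_total (k : ℝ) ((heavySet x (t m)).card : ℝ) with h | h
            · rw [min_eq_left h]
              have := min_le_left (k : ℝ) (N m)
              nlinarith [hS m]
            · rw [min_eq_right h]
              exact (min_le_right _ _).trans h1
          have h3 := mul_le_mul_of_nonneg_left h2 (hw m)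
          have h4 := mul_le_mul_of_nonneg_right (layerWeight_le (p := p) ht0 m) (hS m)
          linarith
      _ ≤ _ := by
          rw [Finset.sum_add_distrib, ← Finset.mul_sum]
          gcongr
  · calc (1 - ε) * (c₀ * topMoment p k x) - ∑ m ∈ Finset.range M, t m ^ p * S m ≤
          ∑ m ∈ Finset.range M, ((1 - ε) * (layerWeight p t m *
            min (k : ℝ) ((heavySet x (t (m + 1))).card : ℝ)) - t m ^ p * S m) := by
          rw [Finset.sum_sub_distrib, ← Finset.mul_sum]
          have : 0 ≤ 1 - ε := by linarith
          gcongr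
      _ ≤ momentEstimate p t M k N := by
          refine Finset.sum_le_sum fun m hm => ?_
          have h1 := (hN m (Finset.mem_range.mp hm)).2
          have h2 : (1 - ε) * min (k : ℝ) ((heavySet x (t (m + 1))).card : ℝ) - S m ≤
              min (k : ℝ) (N m) := by
            refine le_min ?_ (le_trans ?_ h1)
            · have h5 := min_le_left (k : ℝ) ((heavySet x (t (m + 1))).card : ℝ)
              have h6 : 0 ≤ min (k : ℝ) ((heavySet x (t (m + 1))).card : ℝ) := by positivity
              nlinarith [hS m]
            · have h5 := min_le_right (k : ℝ) ((heavySet x (t (m + 1))).card : ℝ)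
              nlinarith
          have h3 := mul_le_mul_of_nonneg_left h2 (hw m)
          have h4 := mul_le_mul_of_nonneg_right (layerWeight_le (p := p) ht0 m) (hS m)
          linarith

end LayerCake

/-! ### Comparison of the Euclidean norm and the `p`-norm -/

section Norms

/-- The power mean inequality with exponent `p / 2`, applied to the squares. -/
theorem sum_sq_le_rpow_mul {n : ℕ} {p : ℝ} (hp : 2 < p) (x : Fin n → ℤ) :
    ∑ i, (x i : ℝ) ^ 2 ≤ (n : ℝ) ^ (1 - 2 / p) * (∑ i, |(x i : ℝ)| ^ p) ^ (2 / p) := by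
  have hp0 : 0 < p := by linarith
  have h1 := Real.rpow_sum_le_const_mul_sum_rpow_of_nonneg (s := Finset.univ)
    (f := fun i : Fin n => (x i : ℝ) ^ 2) (p := p / 2) (by linarith) (fun i _ => sq_nonneg _)
  have h2 : ∀ i, ((x i : ℝ) ^ 2) ^ (p / 2) = |(x i : ℝ)| ^ p := by
    intro i
    rw [← sq_abs, ← Real.rpow_natCast, ← Real.rpow_mul (abs_nonneg _)]
    congr 1; push_cast; ring
  simp only [h2, Finset.card_univ, Fintype.card_fin] at h1
  have h0 : 0 ≤ ∑ i, (x i : ℝ) ^ 2 := Finset.sum_nonneg fun i _ => sq_nonneg _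
  have hF : 0 ≤ ∑ i, |(x i : ℝ)| ^ p := Finset.sum_nonneg fun i _ => by positivity
  have h3 := Real.rpow_le_rpow (by positivity) h1 (show 0 ≤ 2 / p by positivity)
  rw [← Real.rpow_mul h0, Real.mul_rpow (by positivity) hF, ← Real.rpow_mul (by positivity)] at h3
  have h4 : p / 2 * (2 / p) = 1 := by field_simp
  have h5 : (p / 2 - 1) * (2 / p) = 1 - 2 / p := by field_simp
  rwa [h4, h5, Real.rpow_one] at h3

/-- As `a ≥ 1`, the hypothesis also gives `t ≤ F ^ (1 / p)`; the remaining factor `t ^ (p - 2)` is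
bounded by this. -/
theorem mul_rpow_le_of_mul_sq_lt {p a t F : ℝ} (hp : 2 < p) (ha : 1 ≤ a) (ht : 0 < t)
    (hF : 0 ≤ F) (h : a * t ^ 2 < F ^ (2 / p)) : a * t ^ p ≤ F := by
  have hp0 : 0 < p := by linarith
  have h1 : t ^ (2 : ℝ) ≤ F ^ (2 / p) := by
    rw [Real.rpow_two]; nlinarith [sq_nonneg t]
  have h2 : t ^ (p - 2) ≤ F ^ ((p - 2) / p) := by
    have := Real.rpow_le_rpow (by positivity) h1 (show 0 ≤ (p - 2) / 2 by linarith)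
    rw [← Real.rpow_mul ht.le, ← Real.rpow_mul hF] at this
    have e1 : 2 * ((p - 2) / 2) = p - 2 := by ring
    have e2 : 2 / p * ((p - 2) / 2) = (p - 2) / p := by field_simp
    rwa [e1, e2] at this
  have h3 : t ^ p = t ^ 2 * t ^ (p - 2) := by
    rw [← Real.rpow_two, ← Real.rpow_add ht]; congr 1; ring
  have hFp : 0 < F := by
    rcases hF.eq_or_lt with h0 | h0
    · rw [← h0, Real.zero_rpow (by positivity)] at h
      nlinarith [sq_nonneg t]
    · exact h0
  have h4 : F = F ^ (2 / p) * F ^ ((p - 2) / p) := by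
    rw [← Real.rpow_add hFp, ← add_div]
    rw [show (2 + (p - 2)) / p = 1 by field_simp; ring, Real.rpow_one]
  rw [h3, ← mul_assoc]
  calc a * t ^ 2 * t ^ (p - 2) ≤ F ^ (2 / p) * F ^ ((p - 2) / p) := by gcongr
    _ = F := h4.symm

end Norms

/-! ### Realization with random bits and balanced maps -/

section Packaging

/-- A linear sketch from seeds and counters that are indexed by arbitrary finite types. -/
theorem exists_linearSketch {n : ℕ} {Ω ι : Type*} [Fintype Ω] [Fintype ι] {s : ℕ}
    (hΩ : Fintype.card Ω = 2 ^ s) (w : ℕ) (mat : Ω → Matrix ι (Fin n) ℤ)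
    (out : Ω → (ι → ℤ) → ℝ) :
    ∃ A : LinearSketch n, A.seedBits = s ∧ A.rows = Fintype.card ι ∧ A.wordBits = w ∧
      (∀ B : ℕ, (∀ ω x, (∀ i, |x i| ≤ (B : ℤ)) → ∀ j, 2 * |(mat ω).mulVec x j| < 2 ^ w) →
        A.Fits B) ∧
      ∀ ε T x, A.successProb ε T x = unifProb fun ω =>
        (1 - ε) * T ≤ out ω ((mat ω).mulVec x) ∧ out ω ((mat ω).mulVec x) ≤ (1 + ε) * T := by
  classical
  have f : (Fin s → Bool) ≃ Ω := Fintype.equivOfCardEq (by simp [hΩ])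
  let g : ι ≃ Fin (Fintype.card ι) := Fintype.equivFin ι
  refine ⟨⟨s, Fintype.card ι, w, fun ω j i => mat (f ω) (g.symm j) i,
    fun ω v => out (f ω) fun a => v (g a)⟩, rfl, rfl, rfl, ?_, ?_⟩
  · intro B h ω x hx j
    exact h (f ω) x hx (g.symm j)
  · intro ε T x
    rw [← unifProb_equiv f, unifProb_eq_card]
    have h : ∀ ω, (fun a => Matrix.mulVec (fun j i => mat (f ω) (g.symm j) i) x (g a)) =
        (mat (f ω)).mulVec x := by
      intro ω
      ext a
      simp [Matrix.mulVec, dotProduct]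
    simp only [LinearSketch.successProb, LinearSketch.estimate, h, Fintype.card_fun,
      Fintype.card_bool, Fintype.card_fin, Nat.cast_pow, Nat.cast_ofNat]

theorem exists_equidistributed_map {F β : Type*} [Fintype F] [Fintype β] [Nonempty β]
    [DecidableEq β] (h : Fintype.card β ∣ Fintype.card F) :
    ∃ f : F → β, ∀ b,
      (Finset.univ.filter fun u => f u = b).card * Fintype.card β = Fintype.card F := by
  obtain ⟨m, hm⟩ := h
  have e : F ≃ β × Fin m := Fintype.equivOfCardEq (by simp [hm])
  refine ⟨fun u => (e u).1, fun b => ?_⟩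
  have : (Finset.univ.filter fun u => (e u).1 = b).card =
      (Finset.univ.filter fun v : β × Fin m => v.1 = b).card := by
    rw [Finset.card_filter, Finset.card_filter]
    exact Equiv.sum_comp e fun v => if v.1 = b then 1 else 0
  have h2 : (Finset.univ.filter fun v : β × Fin m => v.1 = b) = {b} ×ˢ Finset.univ := by
    ext v; simp [Prod.ext_iff, eq_comm]
  rw [this, h2, hm, Finset.card_product]
  simp [mul_comm]

theorem exists_balanced_sign {F : Type*} [Fintype F] (h : 2 ∣ Fintype.card F) :
    ∃ sg : F → ℤ, (∀ u, |sg u| = 1) ∧ ∑ u, sg u = 0 := by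
  obtain ⟨m, hm⟩ := h
  have e : F ≃ Bool × Fin m := Fintype.equivOfCardEq (by simp [hm])
  refine ⟨fun u => if (e u).1 then 1 else -1, fun u => ?_, ?_⟩
  · dsimp only
    split_ifs <;> simp
  · rw [Equiv.sum_comp e fun v => if v.1 then (1 : ℤ) else -1, Fintype.sum_prod_type]
    simp

end Packaging

/-- Only the levels up to `J` are stored; this makes the values assigned to larger levels
irrelevant. -/
theorem heavyCount_congr {F β : Type*} [Field F] [DecidableEq F] {n L : ℕ}
    (e : Fin n → F) (bk : F → β) (P : ℕ → Finset F) (J K : ℕ)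
    (ω : (F × F) × (Fin L → (F × F) × (F × F))) {y y' : ℕ → Fin L → β → ℤ}
    (h : ∀ j ≤ J, y j = y' j) (θ : ℝ) :
    heavyCount e bk P J K ω y θ = heavyCount e bk P J K ω y' θ := by
  unfold heavyCount countEstimate
  refine Finset.sup_congr rfl fun j hj => ?_
  dsimp only
  rw [h j (by simpa [Nat.lt_succ_iff] using hj)]

/-! ### The counters as a linear map -/

section SketchMatrix

variable {F β : Type*} [Field F] [DecidableEq F] [DecidableEq β] {n L : ℕ}

/-- The sketching matrix; its rows are indexed by the sampling level, the repetition and the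
bucket. -/
def sketchMatrix (e : Fin n → F) (bk : F → β) (sg : F → ℤ) (P : ℕ → Finset F) (J : ℕ)
    (ω : (F × F) × (Fin L → (F × F) × (F × F))) :
    Matrix (Fin (J + 1) × Fin L × β) (Fin n) ℤ := fun r i =>
  if i ∈ hashSample e (P r.1) ω.1 ∧ bk (affineHash e (ω.2 r.2.1).1 i) = r.2.2 then
    sg (affineHash e (ω.2 r.2.1).2 i) else 0

theorem sketchMatrix_mulVec (e : Fin n → F) (bk : F → β) (sg : F → ℤ) (P : ℕ → Finset F) (J : ℕ)
    (ω : (F × F) × (Fin L → (F × F) × (F × F))) (x : Fin n → ℤ)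
    (r : Fin (J + 1) × Fin L × β) :
    (sketchMatrix e bk sg P J ω).mulVec x r = levelCounters e bk sg P x ω r.1 r.2.1 r.2.2 := by
  rw [levelCounters, bucketSum, Finset.sum_filter]
  have : hashSample e (P r.1) ω.1 = Finset.univ.filter fun i => i ∈ hashSample e (P r.1) ω.1 := by
    simp
  rw [this, Finset.sum_filter]
  simp only [Matrix.mulVec, dotProduct, sketchMatrix]
  refine Finset.sum_congr rfl fun i _ => ?_
  by_cases h1 : i ∈ hashSample e (P r.1) ω.1 <;>
    by_cases h2 : bk (affineHash e (ω.2 r.2.1).1 i) = r.2.2 <;> simp [h1, h2]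

theorem abs_sketchMatrix_mulVec_le (e : Fin n → F) (bk : F → β) (sg : F → ℤ)
    (hsg : ∀ u, |sg u| = 1) (P : ℕ → Finset F) (J : ℕ)
    (ω : (F × F) × (Fin L → (F × F) × (F × F))) (x : Fin n → ℤ) {B : ℤ} (hB : 0 ≤ B)
    (hx : ∀ i, |x i| ≤ B)
    (r : Fin (J + 1) × Fin L × β) : |(sketchMatrix e bk sg P J ω).mulVec x r| ≤ n * B := by
  simp only [Matrix.mulVec, dotProduct]
  refine (Finset.abs_sum_le_sum_abs _ _).trans ?_
  refine (Finset.sum_le_sum (g := fun _ => B) fun i _ => ?_).trans (by simp)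
  rw [abs_mul, sketchMatrix]
  split_ifs
  · rw [hsg, one_mul]; exact hx i
  · simpa using hB

end SketchMatrix

/-! ### Geometric thresholds -/

section Thresholds

/-- Geometrically increasing thresholds, with `threshold η 1 = 1`. -/
noncomputable def threshold (η : ℝ) (m : ℕ) : ℝ := (1 + η) ^ m / (1 + η)

variable {η : ℝ}

theorem threshold_pos (hη : 0 < η) (m : ℕ) : 0 < threshold η m := by
  unfold threshold; positivity

theorem threshold_succ (hη : 0 < η) (m : ℕ) : threshold η (m + 1) = (1 + η) * threshold η m := by
  have : (1 + η) ≠ 0 := by positivity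
  unfold threshold; rw [pow_succ]; field_simp

theorem threshold_monotone (hη : 0 < η) : Monotone (threshold η) := by
  refine monotone_nat_of_le_succ fun m => ?_
  rw [threshold_succ hη]
  nlinarith [threshold_pos hη m]

theorem threshold_one (hη : 0 < η) : threshold η 1 = 1 := by
  have : (1 + η) ≠ 0 := by positivity
  unfold threshold; field_simp

theorem exp_mul_threshold_rpow_le {p : ℝ} (hp : 0 ≤ p) (hη : 0 < η) (m : ℕ) :
    Real.exp (-(2 * p * η)) * threshold η (m + 2) ^ p ≤ threshold η m ^ p := by
  have ht := threshold_pos hη m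
  have h1 : threshold η (m + 2) = (1 + η) ^ 2 * threshold η m := by
    rw [threshold_succ hη, threshold_succ hη]; ring
  have h2 : (1 + η) ^ 2 ≤ Real.exp (2 * η) := by
    have := Real.add_one_le_exp η
    calc (1 + η) ^ 2 ≤ Real.exp η ^ 2 := by gcongr; linarith
      _ = Real.exp (2 * η) := by rw [← Real.exp_nat_mul]; norm_num
  have h3 : ((1 + η) ^ 2) ^ p ≤ Real.exp (2 * p * η) := by
    calc ((1 + η) ^ 2) ^ p ≤ Real.exp (2 * η) ^ p := by gcongr
      _ = Real.exp (2 * p * η) := by rw [← Real.exp_mul]; congr 1; ring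
  rw [h1, Real.mul_rpow (by positivity) ht.le, ← mul_assoc]
  have h4 : Real.exp (-(2 * p * η)) * ((1 + η) ^ 2) ^ p ≤ 1 := by
    calc _ ≤ Real.exp (-(2 * p * η)) * Real.exp (2 * p * η) := by gcongr
      _ = 1 := by rw [← Real.exp_add]; simp
  have : 0 ≤ threshold η m ^ p := by positivity
  nlinarith

end Thresholds

theorem topMoment_add_tailMoment {n : ℕ} (p : ℝ) (k : ℕ) (x : Fin n → ℤ) :
    topMoment p k x + tailMoment p k x = ∑ i, |(x i : ℝ)| ^ p := by
  rw [← sum_ranked x fun z => |(z : ℝ)| ^ p, topMoment, tailMoment]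
  rw [← Finset.sum_filter_add_sum_filter_not Finset.univ (fun i : Fin n => (i : ℕ) < k)]
  simp only [not_lt]

theorem topMoment_nonneg {n : ℕ} (p : ℝ) (k : ℕ) (x : Fin n → ℤ) : 0 ≤ topMoment p k x :=
  Finset.sum_nonneg fun _ _ => by positivity

theorem tailMoment_nonneg {n : ℕ} (p : ℝ) (k : ℕ) (x : Fin n → ℤ) : 0 ≤ tailMoment p k x :=
  Finset.sum_nonneg fun _ _ => by positivity

/-! ### Choice of the parameters as powers of `Q` -/

section Parameters

variable {p ε : ℝ} {n d J Q : ℕ}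

/-- Each of the four failure terms is at most `1 / Q`, and `4 / Q ≤ δ`. The value of `τ` makes the
last term equal to `1 / Q`. -/
theorem failure_budget {δ ε τ : ℝ} {n J Q : ℕ} (hQ : 1 ≤ Q) (hδ : 4 ≤ Q * δ) (hε : 0 < ε)
    (hεQ : 1 ≤ Q * ε) (hJ : J + 1 ≤ Q) (hn : n ≤ 2 ^ J) (hτ : τ = 1 / (160 * (Q : ℝ) ^ 10)) :
    (((J : ℝ) + 1) * ((Q ^ 2 : ℕ) + 1) * (2 / (ε ^ 2 * (4 * Q ^ 6 : ℕ))) +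
        (J + 1) * (1 / (Q : ℝ) ^ 2)) +
      ((J + 1) * (Q ^ 2 : ℕ) * (n * τ ^ (5 * Q)) +
        (Q ^ 2 : ℕ) * (8 * (4 * Q ^ 6 : ℕ) * ((5 * Q : ℕ) * τ))) ≤ δ := by
  have hQ' : (1 : ℝ) ≤ Q := by exact_mod_cast hQ
  have hQ0 : (0 : ℝ) < Q := by linarith
  have hJ' : (J : ℝ) + 1 ≤ Q := by exact_mod_cast hJ
  have hJ0 : (0 : ℝ) ≤ J := by positivity
  have h4 : 4 * (1 / (Q : ℝ)) ≤ δ := by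
    rw [mul_one_div, div_le_iff₀ hQ0]; linarith
  have hτ0 : 0 ≤ τ := by rw [hτ]; positivity
  have a1 : ((J : ℝ) + 1) * ((Q ^ 2 : ℕ) + 1) * (2 / (ε ^ 2 * (4 * Q ^ 6 : ℕ))) ≤ 1 / Q := by
    have h1 : 1 ≤ (Q * ε) ^ 2 := one_le_pow₀ hεQ
    have h2 : 2 / (ε ^ 2 * (4 * Q ^ 6 : ℕ)) ≤ 1 / (2 * (Q : ℝ) ^ 4) := by
      push_cast
      rw [div_le_div_iff₀ (by positivity) (by positivity)]
      have : ε ^ 2 * (4 * (Q : ℝ) ^ 6) = 4 * Q ^ 4 * (Q * ε) ^ 2 := by ring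
      rw [this]
      nlinarith [pow_pos hQ0 4]
    have h3 : ((Q ^ 2 : ℕ) : ℝ) + 1 ≤ 2 * (Q : ℝ) ^ 2 := by
      push_cast; nlinarith
    calc _ ≤ (Q : ℝ) * (2 * (Q : ℝ) ^ 2) * (1 / (2 * (Q : ℝ) ^ 4)) := by gcongr
      _ = 1 / Q := by field_simp
  have a2 : ((J : ℝ) + 1) * (1 / (Q : ℝ) ^ 2) ≤ 1 / Q := by
    calc _ ≤ (Q : ℝ) * (1 / (Q : ℝ) ^ 2) := by gcongr
      _ = 1 / Q := by field_simp
  have a3 : ((J : ℝ) + 1) * (Q ^ 2 : ℕ) * (n * τ ^ (5 * Q)) ≤ 1 / Q := by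
    have hn' : (n : ℝ) ≤ 2 ^ Q := by
      have : n ≤ 2 ^ Q := hn.trans (Nat.pow_le_pow_right (by norm_num) (by omega))
      exact_mod_cast this
    have hτ2 : τ ≤ 1 / 2 := by
      rw [hτ]
      refine one_div_le_one_div_of_le (by norm_num) ?_
      have : (1 : ℝ) ≤ (Q : ℝ) ^ 10 := one_le_pow₀ hQ'
      linarith
    have hQ2 : (Q : ℝ) ≤ 2 ^ Q := by exact_mod_cast Nat.lt_two_pow_self.le
    have h2 : (0 : ℝ) < 2 ^ Q := by positivity
    rw [le_div_iff₀ hQ0]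
    push_cast
    -- The factors `J + 1`, `Q ^ 2`, `n` and `Q` together cost at most five factors `2 ^ Q`, which
    -- explains `5 * Q` repetitions.
    calc ((J : ℝ) + 1) * Q ^ 2 * (n * τ ^ (5 * Q)) * Q
        ≤ (2 ^ Q) * (2 ^ Q) ^ 2 * (2 ^ Q * (1 / 2) ^ (5 * Q)) * 2 ^ Q := by
          gcongr
          exact hJ'.trans hQ2
      _ = 1 := by
          rw [one_div, inv_pow, mul_comm 5 Q, pow_mul]
          field_simp
  have a4 : ((Q ^ 2 : ℕ) : ℝ) * (8 * (4 * Q ^ 6 : ℕ) * ((5 * Q : ℕ) * τ)) ≤ 1 / Q := by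
    refine le_of_eq ?_
    rw [hτ]; push_cast; field_simp; norm_num
  linarith

/-- At the levels whose counters are too noisy for the threshold `t`, the cap on the estimates makes
their contribution to the moment negligible. -/
theorem cap_le_of_noisy {x : Fin n → ℤ} {B : ℝ} {j : ℕ} {t : ℝ} (hp : 2 < p) (hn : 0 < n)
    (ht : 0 < t)
    (hQ : 1 ≤ Q) (hεQ : 1 ≤ Q * ε) (hB : 10240 * Q ^ 23 * (n : ℝ) ^ (1 - 2 / p) ≤ B)
    (h : 1 / (160 * (Q : ℝ) ^ 10) * (B * (1 / Q * t / 2) ^ 2) * 2 ^ j <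
      (Q : ℝ) ^ 2 * ∑ i, (x i : ℝ) ^ 2) :
    4 * (4 * Q ^ 6 : ℕ) * 2 ^ j ≤ ε * (∑ i, |(x i : ℝ)| ^ p) / ((Q ^ 2 : ℕ) * t ^ p) := by
  have hQ' : (1 : ℝ) ≤ Q := by exact_mod_cast hQ
  have hQ0 : (0 : ℝ) < Q := by linarith
  have hV : 0 < (n : ℝ) ^ (1 - 2 / p) := by positivity
  have hF : 0 ≤ ∑ i, |(x i : ℝ)| ^ p := Finset.sum_nonneg fun i _ => by positivity
  set V := (n : ℝ) ^ (1 - 2 / p)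
  set F := ∑ i, |(x i : ℝ)| ^ p
  have htp : 0 < t ^ p := by positivity
  have h2j : (1 : ℝ) ≤ 2 ^ j := one_le_pow₀ (by norm_num)
  have hW := sum_sq_le_rpow_mul hp x
  -- The constant in `B` is `10240 = 160 * 4 * 16`: the first two factors cancel `τ` and the square
  -- of the noise bound `t / (2 * Q)`, and `16` matches the cap `4 * (4 * Q ^ 6) * 2 ^ j`.
  have h1 : (16 * Q ^ 9 * 2 ^ j) * t ^ 2 < F ^ (2 / p) := by
    have h2 : 1 / (160 * (Q : ℝ) ^ 10) * ((10240 * Q ^ 23 * V) * (1 / Q * t / 2) ^ 2) * 2 ^ j <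
        (Q : ℝ) ^ 2 * (V * F ^ (2 / p)) := by
      calc _ ≤ 1 / (160 * (Q : ℝ) ^ 10) * (B * (1 / Q * t / 2) ^ 2) * 2 ^ j := by gcongr
        _ < (Q : ℝ) ^ 2 * ∑ i, (x i : ℝ) ^ 2 := h
        _ ≤ _ := by gcongr
    have h3 : 1 / (160 * (Q : ℝ) ^ 10) * ((10240 * Q ^ 23 * V) * (1 / Q * t / 2) ^ 2) * 2 ^ j =
        (Q : ℝ) ^ 2 * V * ((16 * Q ^ 9 * 2 ^ j) * t ^ 2) := by field_simp; norm_num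
    rw [h3, ← mul_assoc ((Q : ℝ) ^ 2) V (F ^ (2 / p))] at h2
    exact lt_of_mul_lt_mul_left h2 (by positivity)
  have hQ9 : (1 : ℝ) ≤ (Q : ℝ) ^ 9 := one_le_pow₀ hQ'
  have h4 := mul_rpow_le_of_mul_sq_lt hp (by nlinarith) ht hF h1
  have hε : 0 < ε := by
    by_contra hcon
    nlinarith
  rw [le_div_iff₀ (by positivity)]
  push_cast
  calc 4 * (4 * (Q : ℝ) ^ 6) * 2 ^ j * (Q ^ 2 * t ^ p)
      = 1 * (16 * Q ^ 8 * 2 ^ j * t ^ p) := by ring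
    _ ≤ Q * ε * (16 * Q ^ 8 * 2 ^ j * t ^ p) := by gcongr
    _ = ε * (16 * Q ^ 9 * 2 ^ j * t ^ p) := by ring
    _ ≤ ε * F := by gcongr

/-- Bernoulli gives `(1 + 1 / Q) ^ Q ≥ 2`, so `Q ^ 2` steps of ratio `1 + 1 / Q` exceed `2 ^ Q > n ^
d`. -/
theorem abs_lt_threshold (hQ : 1 ≤ Q) (hJ : d * J + 1 ≤ Q) (hn : n ≤ 2 ^ J) (x : Fin n → ℤ)
    (hx : ∀ i, |x i| ≤ (n : ℤ) ^ d) (i : Fin n) :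
    |(x i : ℝ)| < threshold (1 / Q) (Q ^ 2 + 1) := by
  have hQ0 : (0 : ℝ) < Q := by exact_mod_cast hQ
  have hη : (0 : ℝ) < 1 / Q := by positivity
  have h1 : |(x i : ℝ)| ≤ (n : ℝ) ^ d := by exact_mod_cast hx i
  have h2 : (n : ℝ) ^ d ≤ 2 ^ (J * d) := by
    rw [pow_mul]
    gcongr
    exact_mod_cast hn
  have h3 : (2 : ℝ) ≤ (1 + 1 / Q) ^ Q := by
    have := one_add_mul_le_pow (show (-2 : ℝ) ≤ 1 / Q by linarith) Q
    have h4 : (Q : ℝ) * (1 / Q) = 1 := by field_simp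
    linarith
  have h5 : threshold (1 / Q) (Q ^ 2 + 1) = ((1 + 1 / (Q : ℝ)) ^ Q) ^ Q := by
    rw [threshold_succ hη, threshold, ← pow_mul, ← sq]; field_simp
  rw [h5]
  calc |(x i : ℝ)| ≤ 2 ^ (J * d) := h1.trans h2
    _ < 2 ^ Q := by
      refine pow_lt_pow_right₀ (by norm_num) ?_
      rw [mul_comm]; omega
    _ ≤ _ := by gcongr

theorem exists_two_pow_between {a : ℝ} (ha : 1 ≤ a) : ∃ b : ℕ, a ≤ 2 ^ b ∧ (2 : ℝ) ^ b ≤ 2 * a := by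
  obtain ⟨b, h1, h2⟩ := exists_nat_pow_near ha (one_lt_two (α := ℝ))
  refine ⟨b + 1, h2.le, ?_⟩
  rw [pow_succ]; linarith

/-- The seed has `2 + 4 * (5 * Q)` field elements of `J + b + 1` bits: two for the sample and four
per repetition. The second summand counts rows times word length. -/
theorem space_budget {J Q b d : ℕ} {V : ℝ} (hQ : 1 ≤ Q) (hJ : (d + 1) * J + 2 ≤ Q)
    (hb : (2 : ℝ) ^ b ≤ 2 * (10240 * Q ^ 23 * V)) :
    (((J + b + 1) * (2 + 4 * (5 * Q)) + (J + 1) * ((5 * Q) * 2 ^ b) * ((d + 1) * J + 2) : ℕ) : ℝ)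
      ≤ 1003520 * (Q : ℝ) ^ 26 * V := by
  have hJ1 : J + 1 ≤ Q := by nlinarith
  have hb2 : b + 1 ≤ 2 ^ b := Nat.lt_two_pow_self
  have h1 : (J + b + 1) * (2 + 4 * (5 * Q)) + (J + 1) * ((5 * Q) * 2 ^ b) * ((d + 1) * J + 2) ≤
      49 * Q ^ 3 * 2 ^ b := by
    have e1 : J + b + 1 ≤ 2 * Q * 2 ^ b := by nlinarith [Nat.one_le_two_pow (n := b)]
    calc _ ≤ (2 * Q * 2 ^ b) * (2 * Q + 4 * (5 * Q)) + Q * ((5 * Q) * 2 ^ b) * Q := by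
          gcongr; omega
      _ = 44 * Q ^ 2 * 2 ^ b + 5 * Q ^ 3 * 2 ^ b := by ring
      _ ≤ 44 * Q ^ 3 * 2 ^ b + 5 * Q ^ 3 * 2 ^ b := by
          gcongr
          norm_num
      _ = 49 * Q ^ 3 * 2 ^ b := by ring
  have h2 : ((49 * Q ^ 3 * 2 ^ b : ℕ) : ℝ) ≤ 1003520 * (Q : ℝ) ^ 26 * V := by
    push_cast
    calc 49 * (Q : ℝ) ^ 3 * 2 ^ b ≤ 49 * (Q : ℝ) ^ 3 * (2 * (10240 * Q ^ 23 * V)) := by gcongr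
      _ = _ := by ring
  exact (Nat.cast_le.mpr h1).trans h2

end Parameters

/-! ### The sketch with additive error -/

/-- A linear sketch that approximates the moment of the `k` largest entries up to an additive error
`ε * ‖x‖_p ^ p`. The number `Q` has to exceed suitable multiples of `p / ε`, `1 / δ` and
`d * log n`. -/
theorem exists_sketch_additive_error {p ε δ : ℝ} {n d J Q : ℕ} (k : ℕ) (hp : 2 < p) (hn : 0 < n)
    (hε0 : 0 < ε) (hε1 : ε < 1) (hQε : 6 * p ≤ Q * ε) (hQδ : 4 ≤ Q * δ)
    (hQJ : (d + 1) * J + 2 ≤ Q) (hnJ : n ≤ 2 ^ J) :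
    ∃ A : LinearSketch n, A.Fits (n ^ d) ∧
      (A.space : ℝ) ≤ 1003520 * (Q : ℝ) ^ 26 * (n : ℝ) ^ (1 - 2 / p) ∧
      ∀ x : Fin n → ℤ, (∀ i, |x i| ≤ (n : ℤ) ^ d) → ∀ ε' : ℝ,
        ε * ∑ i, |(x i : ℝ)| ^ p ≤ ε' * topMoment p k x →
        1 - δ ≤ A.successProb ε' (topMoment p k x) x := by
  classical
  have hQ : 1 ≤ Q := by omega
  have hJ1 : J + 1 ≤ Q := by nlinarith
  have hQ' : (1 : ℝ) ≤ Q := by exact_mod_cast hQ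
  have hQ0 : (0 : ℝ) < Q := by linarith
  have hp0 : 0 < p := by linarith
  have hV1 : 1 ≤ (n : ℝ) ^ (1 - 2 / p) := by
    refine Real.one_le_rpow (by exact_mod_cast hn) ?_
    rw [sub_nonneg, div_le_one hp0]; exact hp.le
  obtain ⟨b, hb1, hb2⟩ := exists_two_pow_between
    (a := 10240 * Q ^ 23 * (n : ℝ) ^ (1 - 2 / p)) (by
      have : (1 : ℝ) ≤ (Q : ℝ) ^ 23 := one_le_pow₀ hQ'
      nlinarith)
  -- This size makes the field contain `n` points and split evenly into `2 ^ b` buckets, two signs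
  -- and samples of every rate down to `2 ^ (-J)`.
  set r := J + b + 1 with hr
  let _ : Fintype (GaloisField 2 r) := Fintype.ofFinite _
  have hF : Fintype.card (GaloisField 2 r) = 2 ^ r := by
    rw [← Nat.card_eq_fintype_card, GaloisField.card 2 r (by omega)]
  obtain ⟨e, he⟩ : ∃ e : Fin n → GaloisField 2 r, Function.Injective e := by
    obtain ⟨f⟩ := Function.Embedding.nonempty_of_card_le
      (α := Fin n) (β := GaloisField 2 r) (by
        rw [hF, Fintype.card_fin]
        exact hnJ.trans (Nat.pow_le_pow_right (by norm_num) (by omega)))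
    exact ⟨f, f.injective⟩
  obtain ⟨bk, hbk⟩ := exists_equidistributed_map (F := GaloisField 2 r) (β := Fin (2 ^ b))
    (by rw [hF, Fintype.card_fin]; exact pow_dvd_pow 2 (by omega))
  obtain ⟨sg, hsg, hsg0⟩ := exists_balanced_sign (F := GaloisField 2 r)
    (by rw [hF]; exact dvd_pow_self 2 (by omega))
  have hPex : ∀ j : ℕ, ∃ P : Finset (GaloisField 2 r), j ≤ J →
      P.card * 2 ^ j = Fintype.card (GaloisField 2 r) := by
    intro j
    obtain ⟨P, -, hP⟩ := Finset.exists_subset_card_eq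
      (s := (Finset.univ : Finset (GaloisField 2 r))) (n := 2 ^ (r - j)) (by
        rw [Finset.card_univ, hF]
        exact Nat.pow_le_pow_right (by norm_num) (by omega))
    refine ⟨P, fun hj => ?_⟩
    rw [hP, hF, ← pow_add]
    congr 1; omega
  choose P hP using hPex
  set η : ℝ := 1 / Q with hη
  have hη0 : 0 < η := by positivity
  set L := 5 * Q with hL
  -- The midpoint of `threshold η m` and `threshold η (m + 1)`, leaving a noise margin of `η *
  -- threshold η m / 2` on both sides.
  let θ : ℕ → ℝ := fun m => threshold η m + η * threshold η m / 2
  let out : (GaloisField 2 r × GaloisField 2 r) × (Fin L →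
      (GaloisField 2 r × GaloisField 2 r) × (GaloisField 2 r × GaloisField 2 r)) →
      (Fin (J + 1) × Fin L × Fin (2 ^ b) → ℤ) → ℝ := fun ω v =>
    momentEstimate p (threshold η) (Q ^ 2) k fun m =>
      heavyCount e bk P J (4 * Q ^ 6) ω (fun j l β => v (Fin.ofNat (J + 1) j, l, β)) (θ m)
  obtain ⟨A, hA1, hA2, hA3, hA4, hA5⟩ := exists_linearSketch (s := r * (2 + 4 * L))
    (by simp only [Fintype.card_prod, Fintype.card_fun, Fintype.card_fin, hF]
        simp only [← pow_add, ← pow_mul]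
        congr 1; ring) ((d + 1) * J + 2) (sketchMatrix e bk sg P J) out
  refine ⟨A, hA4 _ fun ω x hx j => ?_, ?_, fun x hx ε' hε' => ?_⟩
  · have h1 := abs_sketchMatrix_mulVec_le e bk sg hsg P J ω x (by positivity) hx j
    have h2 : (n : ℤ) * (n ^ d : ℕ) ≤ 2 ^ ((d + 1) * J) := by
      have : n * n ^ d ≤ 2 ^ ((d + 1) * J) := by
        calc n * n ^ d = n ^ (d + 1) := by ring
          _ ≤ (2 ^ J) ^ (d + 1) := Nat.pow_le_pow_left hnJ _
          _ = 2 ^ ((d + 1) * J) := by rw [← pow_mul, mul_comm]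
      exact_mod_cast this
    have h3 : (0 : ℤ) < 2 ^ ((d + 1) * J) := by positivity
    rw [pow_add]
    linarith
  · refine le_trans (le_of_eq ?_) (space_budget hQ hQJ hb2)
    rw [LinearSketch.space, hA1, hA2, hA3]
    simp only [Fintype.card_prod, Fintype.card_fin, hr, hL]
  · set F := ∑ i, |(x i : ℝ)| ^ p with hFdef
    have hF0 : 0 ≤ F := Finset.sum_nonneg fun i _ => by positivity
    set T := topMoment p k x with hT
    have hT0 : 0 ≤ T := topMoment_nonneg p k x
    have hTF : T ≤ F := by
      rw [hFdef, ← topMoment_add_tailMoment p k x]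
      linarith [tailMoment_nonneg p k x]
    have hε3Q : 1 ≤ Q * (ε / 3) := by linarith
    -- The additive error `ε / 3 * F` is divided equally among the `Q ^ 2` layers.
    let S : ℕ → ℝ := fun m => ε / 3 * F / ((Q ^ 2 : ℕ) * threshold η m ^ p)
    have ht0 := threshold_pos hη0
    have hS0 : ∀ m, 0 ≤ S m := fun m => by
      have := ht0 m
      positivity
    have hbad := unifProb_heavyCount_bad_le (L := L) e he bk hbk sg hsg hsg0 P (J := J)
      (M := Q ^ 2) (K := 4 * Q ^ 6)
      hP hnJ (by positivity) (ε := ε / 3) (R := (Q : ℝ) ^ 2) (τ := 1 / (160 * (Q : ℝ) ^ 10))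
      (by positivity) (by linarith) (by positivity) (by positivity) (threshold η)
      (fun m => η * threshold η m / 2) (fun m _ => by have := ht0 m; positivity)
      (fun m _ => by rw [threshold_succ hη0]; linarith) S hS0 x
      (fun m _ j _ h => by
        refine cap_le_of_noisy hp hn (ht0 m) hQ hε3Q hb1 (lt_of_le_of_lt (le_of_eq ?_) h)
        rw [Fintype.card_fin]; push_cast; rfl)
    have hbud := hbad.trans (failure_budget hQ hQδ (by positivity) hε3Q hJ1 hnJ rfl)
    rw [hA5]
    have hsum : ∑ m ∈ Finset.range (Q ^ 2), threshold η m ^ p * S m = ε / 3 * F := by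
      have : ∀ m, threshold η m ^ p * S m = ε / 3 * F / (Q ^ 2 : ℕ) := by
        intro m
        have : threshold η m ^ p ≠ 0 := (Real.rpow_pos_of_pos (ht0 m) p).ne'
        simp only [S]; field_simp
      rw [Finset.sum_congr rfl fun m _ => this m, Finset.sum_const, Finset.card_range,
        nsmul_eq_mul]
      push_cast
      field_simp
    rw [unifProb_not] at hbud
    refine (sub_le_comm.mp hbud).trans (unifProb_mono fun ω hω => ?_)
    have hout : out ω ((sketchMatrix e bk sg P J ω).mulVec x) =
        momentEstimate p (threshold η) (Q ^ 2) k fun m =>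
          heavyCount e bk P J (4 * Q ^ 6) ω (levelCounters e bk sg P x ω) (θ m) := by
      simp only [out]
      congr 1
      funext m
      refine heavyCount_congr e bk P J _ ω (fun j hj => ?_) _
      funext l β
      rw [sketchMatrix_mulVec]
      simp only [Fin.ofNat, Nat.mod_eq_of_lt (Nat.lt_succ_of_le hj)]
    have hexp : 1 - ε / 3 ≤ Real.exp (-(2 * p * η)) := by
      have h1 := Real.add_one_le_exp (-(2 * p * η))
      have h2 : 2 * p * η ≤ ε / 3 := by
        rw [hη, mul_one_div, div_le_iff₀ hQ0]; linarith
      linarith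
    have hb := momentEstimate_bounds hp0.le hp0.ne' ht0 (threshold_monotone hη0)
      (threshold_one hη0).le (Real.exp_nonneg _) (exp_mul_threshold_rpow_le hp0.le hη0)
      (Q ^ 2) k x (abs_lt_threshold hQ (by nlinarith) hnJ x hx)
      (ε := ε / 3) (by positivity) (by linarith) _ S hS0 hω
    rw [hsum, ← hT, ← hout] at hb
    -- The error `ε` has three parts: the relative error of the counts, the rounding to thresholds,
    -- and the unresolved levels.
    have h1 : ε / 3 * T ≤ ε / 3 * F := by gcongr
    have h2 : (1 - ε / 3) * ((1 - ε / 3) * T) ≤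
        (1 - ε / 3) * (Real.exp (-(2 * p * η)) * T) := by
      have : 0 ≤ 1 - ε / 3 := by linarith
      gcongr
    have h3 : 0 ≤ ε / 3 * (ε / 3 * T) := by positivity
    constructor
    · linarith [hb.2]
    · linarith [hb.1]

/-! ### From additive to relative error -/

section HeadAndTail

variable {n k : ℕ} {p θ : ℝ} {x : Fin n → ℤ}

/-- Each of the `k` head entries is at least `|a_k|`, which cancels the division by `k`. -/
theorem mul_tailMoment_le_topMoment (hp : 0 ≤ p) (hk : 0 < k) (hkn : k ≤ n)
    (h : HeadDominatesTail p θ k x) : θ * tailMoment p k x ≤ topMoment p k x := by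
  have hk' : (0 : ℝ) < k := by exact_mod_cast hk
  let a : Fin n := ⟨k - 1, by omega⟩
  have h1 := h a (by simp only [a]; omega)
  have h2 : (k : ℝ) * |(ranked x a : ℝ)| ^ p ≤ topMoment p k x := by
    have hcard : (Finset.univ.filter fun i : Fin n => (i : ℕ) < k).card = k := by
      rw [Fin.card_filter_val_lt]; omega
    have := Finset.card_nsmul_le_sum (Finset.univ.filter fun i : Fin n => (i : ℕ) < k)
      (fun i => |(ranked x i : ℝ)| ^ p) (|(ranked x a : ℝ)| ^ p) fun i hi => by
        have hia : i ≤ a := by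
          rw [Finset.mem_filter] at hi
          rw [Fin.le_def]; simp only [a]; omega
        have : |(ranked x a : ℝ)| ≤ |(ranked x i : ℝ)| := by
          exact_mod_cast ranked_abs_antitone x hia
        gcongr
    rwa [hcard, nsmul_eq_mul] at this
  calc θ * tailMoment p k x = k * (θ * (tailMoment p k x / k)) := by field_simp
    _ ≤ k * |(ranked x a : ℝ)| ^ p := by gcongr
    _ ≤ _ := h2

theorem sum_rpow_le_of_headDominatesTail {lam c : ℝ} {c' : ℕ} (hp : 0 ≤ p) (hk : 0 < k)
    (hkn : k ≤ n) (hlam : 1 ≤ lam) (hc : c ≤ c')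
    (h : HeadDominatesTail p (lam⁻¹ ^ c) k x) :
    ∑ i, |(x i : ℝ)| ^ p ≤ 2 * lam ^ c' * topMoment p k x := by
  have hlam0 : 0 < lam := by linarith
  have h1 := mul_tailMoment_le_topMoment hp hk hkn h
  have h2 : (lam ^ c')⁻¹ ≤ lam⁻¹ ^ c := by
    rw [← inv_pow, ← Real.rpow_natCast]
    exact Real.rpow_le_rpow_of_exponent_ge (by positivity) (inv_le_one_of_one_le₀ hlam) hc
  have h3 : (lam ^ c')⁻¹ * tailMoment p k x ≤ topMoment p k x :=
    (mul_le_mul_of_nonneg_right h2 (tailMoment_nonneg p k x)).trans h1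
  rw [inv_mul_le_iff₀ (by positivity)] at h3
  have h4 : topMoment p k x ≤ lam ^ c' * topMoment p k x :=
    le_mul_of_one_le_left (topMoment_nonneg p k x) (one_le_pow₀ hlam)
  rw [← topMoment_add_tailMoment p k x]
  linarith

/-- For `k = 0` the hypothesis is void and the tail is uncontrolled, but the target is an empty sum:
the constant output `0` is exact. -/
theorem exists_sketch_of_eq_zero (n d : ℕ) (p ε δ : ℝ) (hδ : 0 < δ) :
    ∃ A : LinearSketch n, A.Fits (n ^ d) ∧ A.space = 0 ∧
      ∀ x : Fin n → ℤ, 1 - δ ≤ A.successProb ε (topMoment p 0 x) x := by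
  refine ⟨⟨0, 0, 0, fun _ => 0, fun _ _ => 0⟩, fun _ _ _ j => j.elim0, rfl, fun x => ?_⟩
  simp only [LinearSketch.successProb, LinearSketch.estimate, topMoment]
  simp [hδ.le]

end HeadAndTail

theorem clog_two_le {n : ℕ} (hn : 2 ≤ n) : (Nat.clog 2 n : ℝ) ≤ 2 * Real.logb 2 n := by
  have hn0 : (0 : ℝ) < n := by positivity
  have h1 : 1 ≤ Real.logb 2 n := by
    rw [Real.le_logb_iff_rpow_le (by norm_num) hn0]
    simpa using (by exact_mod_cast hn : (2 : ℝ) ≤ n)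
  have h2 : ((Nat.clog 2 n - 1 : ℕ) : ℝ) ≤ Real.logb 2 n := by
    rw [Real.le_logb_iff_rpow_le (by norm_num) hn0, Real.rpow_natCast]
    exact_mod_cast (Nat.pow_pred_clog_lt_self (by norm_num) (by omega)).le
  have h3 : 1 ≤ Nat.clog 2 n := Nat.clog_pos (by norm_num) hn
  push_cast [h3] at h2
  linarith

theorem theorem5 (c : ℝ) :
    ∃ q : ℕ, ∀ p : ℝ, 2 < p → ∀ (d : ℕ) (δ : ℝ), 0 < δ → δ < 1 →
      ∃ C : ℝ, 0 < C ∧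
        ∀ (n k : ℕ) (ε : ℝ), 2 ≤ n → k ≤ n → 0 < ε → ε < 1 →
          ∃ A : LinearSketch n,
            A.Fits (n ^ d) ∧
            (A.space : ℝ) ≤ C * (Real.logb 2 n / ε) ^ q * (n : ℝ) ^ (1 - 2 / p) ∧
            ∀ x : Fin n → ℤ, (∀ i, |x i| ≤ (n : ℤ) ^ d) →
              HeadDominatesTail p ((ε / Real.logb 2 n) ^ c) k x →
              1 - δ ≤ A.successProb ε (topMoment p k x) x := by
  set c' := ⌈c⌉₊ with hc'
  refine ⟨(c' + 1) * 26, fun p hp d δ hδ0 hδ1 => ?_⟩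
  have hp0 : 0 < p := by linarith
  -- The three summands serve the conditions of the additive sketch on accuracy, failure probability
  -- and word length.
  set D : ℝ := 12 * p + 4 / δ + (2 * (d + 1) + 2) with hD
  have hδD : 0 < 4 / δ := by positivity
  have hD1 : 1 ≤ D := by
    have : (0 : ℝ) ≤ d := by positivity
    linarith
  refine ⟨1003520 * (2 * D) ^ 26, by positivity, fun n k ε hn hkn hε0 hε1 => ?_⟩
  have hn0 : (0 : ℝ) < n := by positivity
  have hlog : 1 ≤ Real.logb 2 n := by
    rw [Real.le_logb_iff_rpow_le (by norm_num) hn0]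
    simpa using (by exact_mod_cast hn : (2 : ℝ) ≤ n)
  set lam := Real.logb 2 n / ε with hlam
  have hlogle : Real.logb 2 n ≤ lam := by
    rw [hlam, le_div_iff₀ hε0]; nlinarith
  have hlam1 : 1 ≤ lam := hlog.trans hlogle
  have hinv : ε / Real.logb 2 n = lam⁻¹ := by rw [hlam, inv_div]
  have hεlam : 1 ≤ lam * ε := by rw [hlam, div_mul_cancel₀ _ hε0.ne']; exact hlog
  rcases Nat.eq_zero_or_pos k with rfl | hk
  · obtain ⟨A, h1, h2, h3⟩ := exists_sketch_of_eq_zero n d p ε δ hδ0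
    refine ⟨A, h1, ?_, fun x _ _ => h3 x⟩
    rw [h2, Nat.cast_zero]; positivity
  · have hpow1 : 1 ≤ lam ^ c' := one_le_pow₀ hlam1
    have hpow2 : lam ≤ lam ^ (c' + 1) := by
      rw [pow_succ]; nlinarith
    set Q := ⌈D * lam ^ (c' + 1)⌉₊ with hQ
    have hQle : D * lam ^ (c' + 1) ≤ Q := Nat.le_ceil _
    have hQge : (Q : ℝ) ≤ 2 * D * lam ^ (c' + 1) := by
      have := (Nat.ceil_lt_add_one (show 0 ≤ D * lam ^ (c' + 1) by positivity)).le
      nlinarith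
    have hDQ : D * lam ≤ Q := (by gcongr : D * lam ≤ D * lam ^ (c' + 1)).trans hQle
    have hd0 : (0 : ℝ) ≤ d := by positivity
    have hε' : ε / (2 * lam ^ c') < 1 := by
      rw [div_lt_one (by positivity)]; linarith
    -- Of the power `c' + 1` in `Q`, `c'` factors pay for the reduced accuracy, and the last one for
    -- `ε`, since `lam * ε = log n ≥ 1`.
    have hQp : 6 * p ≤ Q * (ε / (2 * lam ^ c')) := by
      rw [mul_div_assoc', le_div_iff₀ (by positivity)]
      calc 6 * p * (2 * lam ^ c') = 12 * p * lam ^ c' * 1 := by ring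
        _ ≤ D * lam ^ c' * (lam * ε) := by
          gcongr
          linarith
        _ = D * lam ^ (c' + 1) * ε := by ring
        _ ≤ Q * ε := by gcongr
    have hQδ : 4 ≤ Q * δ := by
      have : 4 / δ ≤ Q := by nlinarith
      rwa [div_le_iff₀ hδ0] at this
    have hQJ : (d + 1) * Nat.clog 2 n + 2 ≤ Q := by
      have hJ := (clog_two_le hn).trans (mul_le_mul_of_nonneg_left hlogle zero_le_two)
      have : (((d + 1) * Nat.clog 2 n + 2 : ℕ) : ℝ) ≤ Q := by
        push_cast
        calc ((d : ℝ) + 1) * Nat.clog 2 n + 2 ≤ (d + 1) * (2 * lam) + 2 * lam := by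
              gcongr; linarith
          _ = (2 * (d + 1) + 2) * lam := by ring
          _ ≤ D * lam := by gcongr; linarith
          _ ≤ Q := hDQ
      exact_mod_cast this
    obtain ⟨A, h1, h2, h3⟩ := exists_sketch_additive_error (p := p) (ε := ε / (2 * lam ^ c'))
      (δ := δ) (n := n) (d := d) (J := Nat.clog 2 n) (Q := Q) k hp (by omega) (by positivity)
      hε' hQp hQδ hQJ (Nat.le_pow_clog (by norm_num) n)
    refine ⟨A, h1, h2.trans ?_, fun x hx hdom => h3 x hx ε ?_⟩
    · refine mul_le_mul_of_nonneg_right ?_ (by positivity)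
      rw [pow_mul, mul_assoc, ← mul_pow]
      gcongr
    · rw [hinv] at hdom
      have := sum_rpow_le_of_headDominatesTail hp0.le hk hkn hlam1 (Nat.le_ceil c) hdom
      calc ε / (2 * lam ^ c') * ∑ i, |(x i : ℝ)| ^ p ≤
            ε / (2 * lam ^ c') * (2 * lam ^ c' * topMoment p k x) := by gcongr
        _ = ε * topMoment p k x := by field_simp
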